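/- Let $n\ge 2$ and $\sigma\in(0,1)$, let $\mathbb S^n\subset\mathbb R^{n+1}$ be the unit sphere with its round metric $g$ and volume measure $dV_g$, and let $$P_\sigma=\frac{\Gamma\left(B+\frac12+\sigma\right)}{\Gamma\left(B+\frac12-\sigma\right)},\qquad B=\sqrt{-\Delta_g+\left(\tfrac{n-1}{2}\right)^2},$$ be the self-adjoint operator on $L^2(\mathbb S^n)$ defined by the functional calculus of the Laplace--Beltrami operator; that is, $P_\sigma v=f$ means that $v,f\in L^2(\mathbb S^n)$ and $$\int_{\mathbb S^n} f\varphi\,dV_g=\frac{\Gamma(b+\frac12+\sigma)}{\Gamma(b+\frac12-\sigma)}\int_{\mathbb S^n} v\varphi\,dV_g,\qquad b=\sqrt{\mu+\left(\tfrac{n-1}{2}\right)^2},$$ for every smooth $\varphi$ on $\mathbb S^n$ with $-\Delta_g\varphi=\mu\varphi$. (i) Let $K\in C^1(\mathbb S^n)$ be positive and let $v\in C^2(\mathbb S^n)$ be a positive solution of $$P_\sigma(v)=K\,v^{\frac{n+2\sigma}{n-2\sigma}}\quad\text{on }\mathbb S^n.$$ Then for every conformal Killing vector field $X$ on $\mathbb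 S^n$ (a smooth vector field with $\mathcal L_Xg=2\rho g$ for some function $\rho$), $$\int_{\mathbb S^n}(\nabla_XK)\,v^{\frac{2n}{n-2\sigma}}\,dV_g=0.$$ (ii) In particular, for $K(\xi)=\xi_{n+1}+2$ and every constant $c>0$ (for example $c=1$ or $c=P_\sigma(1)$), the equation $$P_\sigma(v)=c\,K\,v^{\frac{n+2\sigma}{n-2\sigma}}\quad\text{on }\mathbb S^n$$ has no positive solution $v\in C^2(\mathbb S^n)$. -/

import Mathlib

open MeasureTheory
open scoped Manifold ContDiff

noncomputable section

namespace KazdanWarner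

/-- The ambient Euclidean space `ℝ^(n+1)`. -/
abbrev Amb (n : ℕ) : Type := EuclideanSpace ℝ (Fin (n + 1))

/-- The unit sphere `S^n` in `ℝ^(n+1)`. -/
abbrev Sph (n : ℕ) : Type := Metric.sphere (0 : Amb n) 1

/-- The surface measure of the round sphere `S^n`. -/
def surf (n : ℕ) : Measure (Sph n) := (volume : Measure (Amb n)).toSphere

/-- The differential of the inclusion of `S^n` into `ℝ^(n+1)`: the identification of intrinsic
tangent vectors at `ξ` with vectors of `ℝ^(n+1)` orthogonal to `ξ`. -/
def emb {n : ℕ} (ξ : Sph n) (u : TangentSpace (𝓡 n) ξ) : Amb n :=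
  mfderiv (𝓡 n) 𝓘(ℝ, Amb n) (fun ζ : Sph n => (ζ : Amb n)) ξ u

/-- The round metric of `S^n`, induced by the Euclidean inner product. -/
def roundMetric {n : ℕ} (ξ : Sph n) (u w : TangentSpace (𝓡 n) ξ) : ℝ :=
  inner ℝ (emb ξ u) (emb ξ w)

/-- The derivative `D_u X` at `ξ` of a vector field `X` on `S^n`, seen as a map into `ℝ^(n+1)`.
Its component tangent to the sphere is the Levi-Civita covariant derivative `∇_u X`. -/
def ambDeriv {n : ℕ} (X : (ξ : Sph n) → TangentSpace (𝓡 n) ξ) (ξ : Sph n)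
    (u : TangentSpace (𝓡 n) ξ) : Amb n :=
  mfderiv (𝓡 n) 𝓘(ℝ, Amb n) (fun ζ : Sph n => emb ζ (X ζ)) ξ u

/-- The Lie derivative `(L_X g)(u, w) = g(∇_u X, w) + g(u, ∇_w X)` of the round metric.
Pairing with tangent vectors only sees the tangential part of `D_u X`. -/
def lieRoundMetric {n : ℕ} (X : (ξ : Sph n) → TangentSpace (𝓡 n) ξ) (ξ : Sph n)
    (u w : TangentSpace (𝓡 n) ξ) : ℝ :=
  inner ℝ (ambDeriv X ξ u) (emb ξ w) + inner ℝ (emb ξ u) (ambDeriv X ξ w)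

/-- Conformal Killing vector fields of the round sphere: smooth vector fields `X` with
`L_X g = 2 ρ g` for some function `ρ`. -/
structure IsConformalKilling {n : ℕ} (X : (ξ : Sph n) → TangentSpace (𝓡 n) ξ) : Prop where
  smooth : ContMDiff (𝓡 n) (𝓡 n).tangent ∞ (fun ξ => (⟨ξ, X ξ⟩ : TangentBundle (𝓡 n) (Sph n)))
  conformal : ∃ ρ : Sph n → ℝ, ∀ (ξ : Sph n) (u w : TangentSpace (𝓡 n) ξ),
    lieRoundMetric X ξ u w = 2 * ρ ξ * roundMetric ξ u w

/-- The derivative `∇_X K` of the function `K` along the vector field `X`. -/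
def dirDeriv {n : ℕ} (X : (ξ : Sph n) → TangentSpace (𝓡 n) ξ) (K : Sph n → ℝ) (ξ : Sph n) : ℝ :=
  mfderiv (𝓡 n) 𝓘(ℝ, ℝ) K ξ (X ξ)

open scoped Classical in
/-- The extension of a function on `S^n` to `ℝ^(n+1)`, homogeneous of degree zero away from
the origin: `x ↦ φ (x / |x|)`. -/
def homExt {n : ℕ} (φ : Sph n → ℝ) (x : Amb n) : ℝ :=
  if h : x = 0 then 0
  else φ ⟨‖x‖⁻¹ • x, by
    rw [mem_sphere_zero_iff_norm, norm_smul, norm_inv, norm_norm,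
      inv_mul_cancel₀ (norm_ne_zero_iff.mpr h)]⟩

/-- The Laplace-Beltrami operator of the round sphere (with nonpositive spectrum): the Euclidean
Laplacian of the extension homogeneous of degree zero, restricted to the sphere. -/
def laplaceBeltrami {n : ℕ} (φ : Sph n → ℝ) (ξ : Sph n) : ℝ :=
  (Laplacian.laplacian (homExt φ) : Amb n → ℝ) (ξ : Amb n)

/-- `φ` is a smooth eigenfunction (or zero): `-Δ φ = μ φ` on `S^n`. -/
def IsEigenfunction {n : ℕ} (μ : ℝ) (φ : Sph n → ℝ) : Prop :=
  ContMDiff (𝓡 n) 𝓘(ℝ, ℝ) ∞ φ ∧ ∀ ξ, -laplaceBeltrami φ ξ = μ * φ ξ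

/-- The function `Γ(B + 1/2 + σ) / Γ(B + 1/2 - σ)`, with `B = √(μ + ((n-1)/2)²)`, of the spectral
variable `μ` of `-Δ`. -/
def symbolP (n : ℕ) (σ μ : ℝ) : ℝ :=
  Real.Gamma (√(μ + (((n : ℝ) - 1) / 2) ^ 2) + 1 / 2 + σ) /
    Real.Gamma (√(μ + (((n : ℝ) - 1) / 2) ^ 2) + 1 / 2 - σ)

/-- `P_σ v = f`, where `P_σ = Γ(B + 1/2 + σ) / Γ(B + 1/2 - σ)`, `B = √(-Δ + ((n-1)/2)²)`, is the
self-adjoint operator on `L²(S^n)` given by the functional calculus of `-Δ`. As `-Δ` has a complete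
system of smooth eigenfunctions, the pair `(v, f)` of `L²` functions lies in the graph of `P_σ`
exactly if the component of `f` along every eigenfunction is the symbol times that of `v`. -/
def HasPsigma (n : ℕ) (σ : ℝ) (v f : Sph n → ℝ) : Prop :=
  MemLp v 2 (surf n) ∧ MemLp f 2 (surf n) ∧
    ∀ (μ : ℝ) (φ : Sph n → ℝ), IsEigenfunction μ φ →
      ∫ ξ, f ξ * φ ξ ∂(surf n) = symbolP n σ μ * ∫ ξ, v ξ * φ ξ ∂(surf n)

/-- `v` is a positive `C²` solution of `P_σ v = K v^((n+2σ)/(n-2σ))` on `S^n`. -/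
structure IsPositiveSolution (n : ℕ) (σ : ℝ) (K v : Sph n → ℝ) : Prop where
  contMDiff : ContMDiff (𝓡 n) 𝓘(ℝ, ℝ) 2 v
  pos : ∀ ξ, 0 < v ξ
  eqn : HasPsigma n σ v (fun ξ => K ξ * v ξ ^ (((n : ℝ) + 2 * σ) / ((n : ℝ) - 2 * σ)))

end KazdanWarner

end

/-! Write `λ_k` for the eigenvalue of `P_σ` on spherical harmonics of degree `k`, and `q = 2n/(n -
2σ)`. Everything rests on the infinitesimal conformal covariance of `P_σ` in weak form, `∫ P_σ v ·
(X v + (n/2 - σ) ρ v) = 0` (`integral_mul_conformal_eq_zero`). Granting it, insert `P_σ v = K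
v^(q-1)`. Since `q (n/2 - σ) = n`, the integrand multiplied by `q` is `X(K v^q) + n ρ K v^q - (X K)
v^q`. The first two terms together integrate to zero, because `div X = n ρ`; what is left is the
identity of (i).

The covariance is proved on the Lie algebra level, by spherical harmonics. The factor `ρ` is a
harmonic of degree one, and `X + (n/2 - σ) ρ` pairs only neighbouring degrees. For `G` of degree `k`
and `H` of degree `k + 1`, both matrix coefficients are multiples of `∫ ρ G H`: the factor is `-(k +
n/2 + σ)` from `H` to `G` and `k + n/2 - σ` from `G` to `H`. The functional equation of `Γ` gives
`λ_(k+1) (k + n/2 - σ) = λ_k (k + n/2 + σ)`, so the sum over degrees telescopes to one boundary term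
(`sum_pairing_eq`). That term is of size `N ‖λ_N E_N‖ ‖E_(N+1)‖`, with `E_k` the components of `v`.
It vanishes in the limit: `λ_N E_N` is a component of the continuous function `P_σ v`, and `N ‖E_N‖`
is bounded as `v` is `C¹`.

All calculus takes place in `ℝ^(n+1)` minus the origin. Functions and fields are extended
homogeneously, and the only integration by parts is `∫ ∂_i F = (m + n) ∫ ξ_i F` over the sphere for
`F` of degree `m` (`integral_pd`). Euler's identity then replaces every radial derivative by a
number.

For (ii), `X` is the gradient of the last coordinate, for which `X K = 1 - ξ_(n+1)²` is nonnegative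
and not identically zero. -/

noncomputable section

namespace KazdanWarner

/-! ### Partial derivatives and homogeneous functions on the punctured space -/

variable {n : ℕ}

/-- The `i`-th partial derivative. -/
def pd (i : Fin (n + 1)) (F : Amb n → ℝ) (x : Amb n) : ℝ :=
  fderiv ℝ F x (EuclideanSpace.single i 1)

lemma fderiv_apply_eq_sum_pd (F : Amb n → ℝ) (x u : Amb n) :
    fderiv ℝ F x u = ∑ i, u i * pd i F x := by
  conv_lhs => rw [← (EuclideanSpace.basisFun (Fin (n + 1)) ℝ).sum_repr u]
  simp [pd]

lemma pd_add {i : Fin (n + 1)} {F G : Amb n → ℝ} {x : Amb n} (hF : DifferentiableAt ℝ F x)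
    (hG : DifferentiableAt ℝ G x) : pd i (fun y => F y + G y) x = pd i F x + pd i G x := by
  simp [pd, fderiv_fun_add hF hG]

lemma pd_sub {i : Fin (n + 1)} {F G : Amb n → ℝ} {x : Amb n} (hF : DifferentiableAt ℝ F x)
    (hG : DifferentiableAt ℝ G x) : pd i (fun y => F y - G y) x = pd i F x - pd i G x := by
  simp [pd, fderiv_fun_sub hF hG]

lemma pd_mul {i : Fin (n + 1)} {F G : Amb n → ℝ} {x : Amb n} (hF : DifferentiableAt ℝ F x)
    (hG : DifferentiableAt ℝ G x) :
    pd i (fun y => F y * G y) x = pd i F x * G x + F x * pd i G x := by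
  simp [pd, fderiv_fun_mul hF hG]; ring

lemma pd_const_mul {i : Fin (n + 1)} {F : Amb n → ℝ} {x : Amb n} (c : ℝ)
    (hF : DifferentiableAt ℝ F x) : pd i (fun y => c * F y) x = c * pd i F x := by
  simp [pd, fderiv_const_mul hF]

lemma pd_sum {ι : Type*} {i : Fin (n + 1)} {s : Finset ι} {F : ι → Amb n → ℝ} {x : Amb n}
    (hF : ∀ j ∈ s, DifferentiableAt ℝ (F j) x) :
    pd i (fun y => ∑ j ∈ s, F j y) x = ∑ j ∈ s, pd i (F j) x := by
  simp [pd, fderiv_fun_sum hF]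

lemma pd_coord (i j : Fin (n + 1)) (x : Amb n) :
    pd i (fun y : Amb n => y j) x = if i = j then 1 else 0 := by
  have : fderiv ℝ (fun y : Amb n => y j) x = (EuclideanSpace.proj j : Amb n →L[ℝ] ℝ) :=
    (EuclideanSpace.proj j : Amb n →L[ℝ] ℝ).fderiv
  simp only [pd, this]
  simp [eq_comm]

lemma pd_norm (i : Fin (n + 1)) {x : Amb n} (hx : x ≠ 0) :
    pd i (fun y : Amb n => ‖y‖) x = x i / ‖x‖ := by
  have h := (hasStrictFDerivAt_norm_sq x).hasFDerivAt.sqrt (by positivity)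
  have h2 : (fun y : Amb n => √(‖y‖ ^ 2)) = fun y => ‖y‖ := by
    ext y; exact Real.sqrt_sq (norm_nonneg y)
  rw [h2] at h
  simp only [pd, h.fderiv, Real.sqrt_sq (norm_nonneg x)]
  simp [EuclideanSpace.inner_single_right]
  field_simp

lemma pd_congr {i : Fin (n + 1)} {F G : Amb n → ℝ} {x : Amb n} (h : F =ᶠ[nhds x] G) :
    pd i F x = pd i G x := by simp [pd, h.fderiv_eq]

lemma coe_ne_zero (ξ : Sph n) : (ξ : Amb n) ≠ 0 :=
  ne_zero_of_mem_unit_sphere ξ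

lemma norm_coe (ξ : Sph n) : ‖(ξ : Amb n)‖ = 1 := norm_eq_of_mem_sphere ξ

lemma norm_sq_eq_sum (x : Amb n) : ‖x‖ ^ 2 = ∑ i, x i * x i := by
  rw [EuclideanSpace.norm_sq_eq]; simp [sq]

lemma sum_coe_mul_self (ξ : Sph n) : ∑ i, (ξ : Amb n) i * (ξ : Amb n) i = 1 := by
  rw [← norm_sq_eq_sum, norm_coe]; norm_num

/-- `F` is positively homogeneous of degree `m` away from the origin. -/
def IsHomog (m : ℝ) (F : Amb n → ℝ) : Prop :=
  ∀ t : ℝ, 0 < t → ∀ x : Amb n, x ≠ 0 → F (t • x) = t ^ m * F x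

/-- `F` is `C¹` and positively homogeneous of degree `m` away from the origin. -/
structure HomogC1 (m : ℝ) (F : Amb n → ℝ) : Prop where
  contDiffAt : ∀ x : Amb n, x ≠ 0 → ContDiffAt ℝ 1 F x
  hom : IsHomog m F

namespace HomogC1
variable {m m' : ℝ} {F G : Amb n → ℝ}

lemma differentiableAt (h : HomogC1 m F) {x : Amb n} (hx : x ≠ 0) : DifferentiableAt ℝ F x :=
  (h.contDiffAt x hx).differentiableAt (by norm_num)

lemma mul (hF : HomogC1 m F) (hG : HomogC1 m' G) : HomogC1 (m + m') (fun x => F x * G x) where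
  contDiffAt x hx := (hF.contDiffAt x hx).mul (hG.contDiffAt x hx)
  hom t ht x hx := by
    beta_reduce
    rw [hF.hom t ht x hx, hG.hom t ht x hx, Real.rpow_add ht]; ring

lemma congr_degree (hF : HomogC1 m F) (h : m = m') : HomogC1 m' F := h ▸ hF

lemma euler (h : HomogC1 m F) {x : Amb n} (hx : x ≠ 0) : ∑ i, x i * pd i F x = m * F x := by
  rw [← fderiv_apply_eq_sum_pd]
  have h1 : HasDerivAt (fun t : ℝ => F (t • x)) (fderiv ℝ F x x) 1 := by
    have hd : HasFDerivAt F (fderiv ℝ F x) ((1 : ℝ) • x) := by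
      rw [one_smul]; exact (h.differentiableAt hx).hasFDerivAt
    have h0 : HasDerivAt (fun t : ℝ => t • x) x 1 := by
      simpa using (hasDerivAt_id (1 : ℝ)).smul_const x
    exact hd.comp_hasDerivAt (1 : ℝ) h0
  have h2 : HasDerivAt (fun t : ℝ => t ^ m * F x) (m * F x) 1 := by
    have := (Real.hasDerivAt_rpow_const (x := 1) (p := m) (Or.inl one_ne_zero)).mul_const (F x)
    simpa using this
  refine h1.unique (h2.congr_of_eventuallyEq ?_)
  filter_upwards [lt_mem_nhds (show (0 : ℝ) < 1 by norm_num)] with t ht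
  exact h.hom t ht x hx

lemma pd_isHomog (h : HomogC1 m F) (i : Fin (n + 1)) : IsHomog (m - 1) (pd i F) := by
  intro t ht x hx
  have htx : t • x ≠ 0 := smul_ne_zero ht.ne' hx
  have h1 : HasFDerivAt (fun y : Amb n => F (t • y)) (t • fderiv ℝ F (t • x)) x := by
    have h0 : HasFDerivAt (fun y : Amb n => t • y) (t • ContinuousLinearMap.id ℝ (Amb n)) x :=
      (hasFDerivAt_id x).const_smul t
    refine ((h.differentiableAt htx).hasFDerivAt.comp x h0).congr_fderiv ?_
    ext u; simp
  have h2 : HasFDerivAt (fun y : Amb n => F (t • y)) (t ^ m • fderiv ℝ F x) x := by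
    refine (((h.differentiableAt hx).hasFDerivAt).const_mul (t ^ m)).congr_of_eventuallyEq ?_
    filter_upwards [isOpen_ne.mem_nhds hx] with y hy
    exact h.hom t ht y hy
  have h3 := congrArg (fun L => L (EuclideanSpace.single i 1)) (h1.unique h2)
  simp only [smul_apply, smul_eq_mul] at h3
  rw [pd, pd, Real.rpow_sub_one ht.ne']
  field_simp
  linarith

lemma continuousAt_pd (h : HomogC1 m F) (i : Fin (n + 1)) {x : Amb n} (hx : x ≠ 0) :
    ContinuousAt (pd i F) x := by
  have := (h.contDiffAt x hx).fderiv_right (m := 0) (by norm_num)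
  exact (this.continuousAt).clm_apply continuousAt_const

lemma continuous_coe (h : HomogC1 m F) : Continuous (fun ξ : Sph n => F ξ) :=
  continuous_iff_continuousAt.2 fun ξ =>
    ((h.contDiffAt ξ (coe_ne_zero ξ)).continuousAt).comp continuous_subtype_val.continuousAt

lemma continuous_coe_pd (h : HomogC1 m F) (i : Fin (n + 1)) :
    Continuous (fun ξ : Sph n => pd i F ξ) :=
  continuous_iff_continuousAt.2 fun ξ =>
    (h.continuousAt_pd i (coe_ne_zero ξ)).comp
      (f := fun ξ : Sph n => (ξ : Amb n)) continuous_subtype_val.continuousAt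

end HomogC1

lemma homogC1_coord (i : Fin (n + 1)) : HomogC1 1 (fun x : Amb n => x i) where
  contDiffAt x _ := by fun_prop
  hom t _ x _ := by simp

lemma homogC1_norm_rpow (m : ℝ) : HomogC1 m (fun x : Amb n => ‖x‖ ^ m) where
  contDiffAt x hx := (contDiffAt_norm ℝ hx).rpow_const_of_ne (norm_ne_zero_iff.2 hx)
  hom t ht x _ := by
    beta_reduce
    rw [norm_smul, Real.norm_of_nonneg ht.le, Real.mul_rpow ht.le (norm_nonneg x)]

/-! ### Polar coordinates and the divergence theorem on the sphere -/

instance : IsFiniteMeasure (surf n) := by unfold surf; infer_instance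

lemma integrable_surf {f : Sph n → ℝ} (hf : Continuous f) : Integrable f (surf n) :=
  hf.integrable_of_hasCompactSupport (HasCompactSupport.of_compactSpace f)

/-- Polar coordinates: Lebesgue measure is `r^n dr` times the surface measure, and `F (r ξ) = r^m F
ξ`, so the integral factors. No integrability is assumed. -/
lemma integral_radial_mul_homog {m : ℝ} {F : Amb n → ℝ} (hF : IsHomog m F) (ψ : ℝ → ℝ) :
    ∫ x : Amb n, ψ ‖x‖ * F x =
      (∫ r in Set.Ioi (0 : ℝ), r ^ (n : ℝ) * (ψ r * r ^ m)) * ∫ ξ, F ξ ∂surf n := by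
  have key := (volume : Measure (Amb n)).measurePreserving_homeomorphUnitSphereProd.integral_comp
    (Homeomorph.measurableEmbedding _)
    (fun p : Metric.sphere (0 : Amb n) 1 × Set.Ioi (0 : ℝ) =>
      F p.1 * (ψ p.2 * (p.2 : ℝ) ^ m))
  rw [integral_prod_mul (f := fun ξ : Metric.sphere (0 : Amb n) 1 => F ξ)
    (g := fun r : Set.Ioi (0 : ℝ) => ψ r * (r : ℝ) ^ m)] at key
  have hl : ∫ x : Amb n, ψ ‖x‖ * F x =
      ∫ x : ({0}ᶜ : Set (Amb n)), F ((homeomorphUnitSphereProd (Amb n) x).1 : Amb n) *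
        (ψ ((homeomorphUnitSphereProd (Amb n) x).2 : ℝ) *
          (((homeomorphUnitSphereProd (Amb n)) x).2 : ℝ) ^ m) ∂(volume.comap Subtype.val) := by
    have hsub := integral_subtype_comap (μ := (volume : Measure (Amb n)))
      (measurableSet_singleton (0 : Amb n)).compl (fun x : Amb n => ψ ‖x‖ * F x)
    rw [restrict_compl_singleton] at hsub
    rw [← hsub]
    refine integral_congr_ae (Filter.Eventually.of_forall fun x => ?_)
    have hx : (x : Amb n) ≠ 0 := x.2
    have hx' : 0 < ‖(x : Amb n)‖ := norm_pos_iff.2 hx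
    have h1 := hF ‖(x : Amb n)‖⁻¹ (by positivity) x hx
    simp only [homeomorphUnitSphereProd_apply_fst_coe, homeomorphUnitSphereProd_apply_snd_coe, h1,
      Real.inv_rpow hx'.le]
    field_simp
  rw [hl, key, mul_comm]
  congr 1
  simp only [Measure.volumeIoiPow, ENNReal.ofReal]
  rw [integral_withDensity_eq_integral_smul
      ((measurable_subtype_coe.pow_const _).real_toNNReal),
    integral_subtype_comap measurableSet_Ioi
      fun a => Real.toNNReal (a ^ (Module.finrank ℝ (Amb n) - 1)) • (ψ a * a ^ m)]
  refine setIntegral_congr_fun measurableSet_Ioi fun r hr => ?_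
  have hr' : (0 : ℝ) < r := hr
  simp [NNReal.smul_def, hr'.le]

/-- The divergence theorem on the sphere, for homogeneous functions. -/
theorem integral_pd {m : ℝ} {F : Amb n → ℝ} (hF : HomogC1 m F) (i : Fin (n + 1)) :
    ∫ ξ, pd i F ξ ∂surf n = (m + n) * ∫ ξ, (ξ : Amb n) i * F ξ ∂surf n := by
  -- A radial cutoff supported in `1 ≤ r ≤ 3`, which removes the singularity of `F` at the origin
  -- and makes the integrand compactly supported, so that a partial derivative integrates to zero
  -- over the whole space.
  let χ : ContDiffBump (2 : ℝ) := ⟨1 / 2, 1, by norm_num, by norm_num⟩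
  have hχ0 : ∀ r : ℝ, r ≤ 1 → χ r = 0 := fun r hr => χ.zero_of_le_dist (by
    rw [Real.dist_eq, abs_sub_comm, abs_of_nonneg] <;> simp [χ] <;> linarith)
  have hχsupp : HasCompactSupport χ := χ.hasCompactSupport
  have hχC : ContDiff ℝ 1 χ := χ.contDiff
  -- The exponent cancels the volume factor and the homogeneity: the two radial integrals become `J
  -- = ∫ χ/r` and `∫ χ' - (m + n) J = -(m + n) J`, and dividing by `J > 0` gives the claim.
  let ψ : ℝ → ℝ := fun r => χ r * r ^ (-(m + n))
  let ψ' : ℝ → ℝ := fun r => deriv χ r * r ^ (-(m + n)) - (m + n) * (χ r * r ^ (-(m + n) - 1))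
  have hψ' : ∀ r, 0 < r → HasDerivAt ψ (ψ' r) r := by
    intro r hr
    have := ((hχC.differentiable (by norm_num)) r).hasDerivAt.mul
      (Real.hasDerivAt_rpow_const (x := r) (p := -(m + n)) (Or.inl hr.ne'))
    refine this.congr_deriv ?_
    simp only [ψ']; ring
  let Φ : Amb n → ℝ := fun x => ψ ‖x‖ * F x
  have hΦ0 : ∀ x : Amb n, ‖x‖ ≤ 1 → Φ x = 0 := fun x hx => by simp [Φ, ψ, hχ0 _ hx]
  have hΦnhds : ∀ x : Amb n, ‖x‖ < 1 → Φ =ᶠ[nhds x] fun _ => 0 := fun x hx => by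
    filter_upwards [(isOpen_lt continuous_norm continuous_const).mem_nhds hx] with y hy
    exact hΦ0 y (le_of_lt hy)
  have hΦC : ContDiff ℝ 1 Φ := by
    rw [contDiff_iff_contDiffAt]
    intro x
    by_cases hx : ‖x‖ < 1
    · exact contDiffAt_const.congr_of_eventuallyEq (hΦnhds x hx)
    · have hx0 : x ≠ 0 := by rintro rfl; simp at hx
      have hn : ContDiffAt ℝ 1 (fun y : Amb n => ‖y‖) x := contDiffAt_norm ℝ hx0
      exact ((hχC.contDiffAt.comp x hn).mul (hn.rpow_const_of_ne (norm_ne_zero_iff.2 hx0))).mul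
        (hF.contDiffAt x hx0)
  have hΦsupp : HasCompactSupport Φ := by
    refine HasCompactSupport.of_support_subset_isCompact (isCompact_closedBall (0 : Amb n) 3) ?_
    intro x hx
    by_contra h
    apply hx
    have : χ ‖x‖ = 0 := χ.zero_of_le_dist (by
      simp only [Metric.mem_closedBall, dist_zero_right, not_le] at h
      rw [Real.dist_eq, abs_of_nonneg] <;> simp [χ] <;> linarith)
    simp [Φ, ψ, this]
  have hpdΦ : ∀ x : Amb n, pd i Φ x = ψ ‖x‖ * pd i F x + (ψ' ‖x‖ / ‖x‖) * (x i * F x) := by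
    intro x
    by_cases hx : ‖x‖ < 1
    · have h1 : pd i Φ x = 0 := by rw [pd_congr (hΦnhds x hx)]; simp [pd]
      have h2 : deriv χ ‖x‖ = 0 := by
        have : (χ : ℝ → ℝ) =ᶠ[nhds ‖x‖] fun _ => 0 := by
          filter_upwards [gt_mem_nhds hx] with y hy using hχ0 y (le_of_lt hy)
        rw [this.deriv_eq]; simp
      rw [h1]
      simp [ψ, ψ', hχ0 _ hx.le, h2]
    · have hx0 : x ≠ 0 := by rintro rfl; simp at hx
      have hd := hψ' ‖x‖ (norm_pos_iff.2 hx0)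
      have hnd : DifferentiableAt ℝ (fun y : Amb n => ‖y‖) x :=
        (contDiffAt_norm ℝ (n := 1) hx0).differentiableAt (by norm_num)
      have hc := hd.comp_hasFDerivAt x hnd.hasFDerivAt
      have hpn := pd_norm i hx0
      have : pd i (fun y : Amb n => ψ ‖y‖) x = ψ' ‖x‖ * (x i / ‖x‖) := by
        rw [← hpn, pd, pd]
        have e : fderiv ℝ (fun y : Amb n => ψ ‖y‖) x = _ := hc.fderiv
        rw [e]; simp
      have hc' : DifferentiableAt ℝ (fun y : Amb n => ψ ‖y‖) x := hc.differentiableAt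
      simp only [Φ]
      rw [pd_mul hc' (hF.differentiableAt hx0), this]
      ring
  have hzero : ∫ x, pd i Φ x = 0 := by
    have := integral_mul_fderiv_eq_neg_fderiv_mul_of_integrable (μ := (volume : Measure (Amb n)))
      (f := fun _ => (1 : ℝ)) (g := Φ) (v := EuclideanSpace.single i 1)
      (by simp) ?_ ?_ (by simp) (fun x _ => hΦC.differentiable (by norm_num) x)
    · simpa [pd] using this
    · simp only [one_mul]
      exact (((hΦC.continuous_fderiv (by norm_num)).clm_apply continuous_const)
        |>.integrable_of_hasCompactSupport ((hΦsupp.fderiv ℝ).comp_left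
          (g := fun L : Amb n →L[ℝ] ℝ => L (EuclideanSpace.single i 1)) rfl))
    · simpa using hΦC.continuous.integrable_of_hasCompactSupport hΦsupp
  have hχsupp' : ∀ r : ℝ, 3 ≤ r → χ r = 0 := fun r hr => χ.zero_of_le_dist (by
      rw [Real.dist_eq, abs_of_nonneg] <;> simp [χ] <;> linarith)
  set J : ℝ := ∫ r in Set.Ioi (0 : ℝ), χ r * r⁻¹ with hJ
  have hintJ : IntegrableOn (fun r => χ r * r⁻¹) (Set.Ioi (0 : ℝ)) := by
    have hc : Continuous (fun r => χ r * r⁻¹) := by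
      rw [continuous_iff_continuousAt]
      intro r
      rcases lt_or_ge r 1 with hr | hr
      · have : (fun r => χ r * r⁻¹) =ᶠ[nhds r] fun _ => 0 := by
          filter_upwards [gt_mem_nhds hr] with y hy
          simp [hχ0 y (le_of_lt hy)]
        exact continuousAt_const.congr this.symm
      · exact χ.continuous.continuousAt.mul (continuousAt_inv₀ (by linarith))
    exact (hc.integrable_of_hasCompactSupport hχsupp.mul_right).integrableOn
  have hJpos : 0 < J := by
    rw [hJ, setIntegral_pos_iff_support_of_nonneg_ae]
    · refine lt_of_lt_of_le (b := volume (Set.Ioo (3 / 2 : ℝ) (5 / 2))) (by simp; norm_num)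
        (measure_mono ?_)
      intro r hr
      have hpos : 0 < r := by linarith [hr.1]
      refine ⟨mul_ne_zero (χ.pos_of_mem_ball ?_).ne' (inv_ne_zero hpos.ne'), hpos⟩
      rw [Metric.mem_ball, Real.dist_eq, abs_lt]
      exact ⟨by simp [χ]; linarith [hr.1], by simp [χ]; linarith [hr.2]⟩
    · filter_upwards [ae_restrict_mem measurableSet_Ioi] with r hr
      exact mul_nonneg χ.nonneg (inv_nonneg.2 (le_of_lt hr))
    · exact hintJ
  have hA : ∫ r in Set.Ioi (0 : ℝ), r ^ (n : ℝ) * (ψ r * r ^ (m - 1)) = J := by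
    refine setIntegral_congr_fun measurableSet_Ioi fun r hr => ?_
    have hr' : (0 : ℝ) < r := hr
    simp only [ψ]
    calc r ^ (n : ℝ) * (χ r * r ^ (-(m + n)) * r ^ (m - 1))
        = χ r * (r ^ (n : ℝ) * r ^ (-(m + n)) * r ^ (m - 1)) := by ring
      _ = χ r * r⁻¹ := by
        rw [← Real.rpow_add hr', ← Real.rpow_add hr', ← Real.rpow_neg_one]; ring_nf
  have hB : ∫ r in Set.Ioi (0 : ℝ), r ^ (n : ℝ) * (ψ' r / r * r ^ (m + 1)) = -(m + n) * J := by
    have h1 : ∫ r in Set.Ioi (0 : ℝ), deriv χ r = 0 := by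
      rw [hχsupp.integral_Ioi_deriv_eq hχC 0, hχ0 0 (by norm_num), neg_zero]
    have h2 : ∀ r ∈ Set.Ioi (0 : ℝ), r ^ (n : ℝ) * (ψ' r / r * r ^ (m + 1)) =
        deriv χ r - (m + n) * (χ r * r⁻¹) := by
      intro r hr
      have hr' : (0 : ℝ) < r := hr
      have e1 : r ^ (n : ℝ) * r ^ (-(m + n)) * r ^ (m + 1) / r = 1 := by
        rw [← Real.rpow_add hr', ← Real.rpow_add hr']
        rw [show (n : ℝ) + -(m + n) + (m + 1) = 1 by ring, Real.rpow_one, div_self hr'.ne']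
      have e2 : r ^ (-(m + n) - 1) = r ^ (-(m + n)) * r⁻¹ := by
        rw [Real.rpow_sub_one hr'.ne', div_eq_mul_inv]
      simp only [ψ', e2]
      linear_combination (deriv χ r - (m + n) * (χ r * r⁻¹)) * e1
    rw [setIntegral_congr_fun measurableSet_Ioi h2, integral_sub, h1, integral_const_mul]
    · ring
    · exact ((hχC.continuous_deriv (by norm_num)).integrable_of_hasCompactSupport
        hχsupp.deriv).integrableOn
    · exact hintJ.const_mul _
  have i0 : Integrable (fun x : Amb n => pd i Φ x) :=
    ((hΦC.continuous_fderiv (by norm_num)).clm_apply continuous_const)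
      |>.integrable_of_hasCompactSupport ((hΦsupp.fderiv ℝ).comp_left
        (g := fun L : Amb n →L[ℝ] ℝ => L (EuclideanSpace.single i 1)) rfl)
  have i1 : Integrable (fun x : Amb n => ψ ‖x‖ * pd i F x) := by
    have hc : Continuous (fun x : Amb n => ψ ‖x‖ * pd i F x) := by
      rw [continuous_iff_continuousAt]
      intro x
      by_cases hx : ‖x‖ < 1
      · refine (continuousAt_const (y := (0 : ℝ))).congr ?_
        filter_upwards [(isOpen_lt continuous_norm continuous_const).mem_nhds hx] with y hy
        simp [ψ, hχ0 _ (le_of_lt hy)]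
      · have hx0 : x ≠ 0 := by rintro rfl; simp at hx
        exact ((χ.continuous.comp continuous_norm).continuousAt.mul
          (continuous_norm.continuousAt.rpow_const (Or.inl (norm_ne_zero_iff.2 hx0)))).mul
          (hF.continuousAt_pd i hx0)
    refine hc.integrable_of_hasCompactSupport (HasCompactSupport.of_support_subset_isCompact
      (isCompact_closedBall (0 : Amb n) 3) ?_)
    intro x hx
    by_contra h
    apply hx
    simp only [Metric.mem_closedBall, dist_zero_right, not_le] at h
    simp [ψ, hχsupp' _ h.le]
  have i2 : Integrable (fun x : Amb n => (ψ' ‖x‖ / ‖x‖) * (x i * F x)) := by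
    refine (i0.sub i1).congr (Filter.Eventually.of_forall fun x => ?_)
    simp [hpdΦ x]
  have hsplit := hzero
  simp_rw [hpdΦ] at hsplit
  rw [integral_add i1 i2, integral_radial_mul_homog (hF.pd_isHomog i) ψ, hA,
    integral_radial_mul_homog (m := m + 1) (F := fun x => x i * F x)
      (((homogC1_coord i).mul hF).congr_degree (add_comm 1 m)).hom (fun r => ψ' r / r), hB]
    at hsplit
  have : J * (∫ ξ, pd i F ξ ∂surf n - (m + n) * ∫ ξ, (ξ : Amb n) i * F ξ ∂surf n) = 0 := by
    linear_combination hsplit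
  rcases mul_eq_zero.1 this with h | h
  · exact absurd h hJpos.ne'
  · linarith

/-! ### Solid harmonics -/

lemma contDiff_pd {H : Amb n → ℝ} (hH : ContDiff ℝ ∞ H) (i : Fin (n + 1)) :
    ContDiff ℝ ∞ (pd i H) :=
  (hH.fderiv_right (m := ∞) (by simp)).clm_apply contDiff_const

lemma pd_pd_eq {H : Amb n → ℝ} {x : Amb n} (hH : ContDiffAt ℝ 2 H x) (i j : Fin (n + 1)) :
    pd i (pd j H) x =
      fderiv ℝ (fderiv ℝ H) x (EuclideanSpace.single i 1) (EuclideanSpace.single j 1) := by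
  have hd : DifferentiableAt ℝ (fderiv ℝ H) x :=
    (hH.fderiv_right (m := 1) (by norm_num)).differentiableAt (by norm_num)
  rw [pd]
  change fderiv ℝ (fun y => fderiv ℝ H y (EuclideanSpace.single j 1)) x _ = _
  rw [fderiv_clm_apply hd (differentiableAt_const _)]
  simp

lemma pd_comm {H : Amb n → ℝ} (hH : ContDiff ℝ ∞ H) (i j : Fin (n + 1)) :
    pd i (pd j H) = pd j (pd i H) := by
  ext x
  have h2 : ContDiffAt ℝ 2 H x := (contDiff_infty.1 hH 2).contDiffAt
  rw [pd_pd_eq h2, pd_pd_eq h2]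
  exact (h2.isSymmSndFDerivAt (by simp)) _ _

lemma laplacian_eq_sum_pd {H : Amb n → ℝ} {x : Amb n} (hH : ContDiffAt ℝ 2 H x) :
    (Laplacian.laplacian H : Amb n → ℝ) x = ∑ i, pd i (pd i H) x := by
  rw [InnerProductSpace.laplacian_eq_iteratedFDeriv_orthonormalBasis H
    (EuclideanSpace.basisFun (Fin (n + 1)) ℝ)]
  refine Finset.sum_congr rfl fun i _ => ?_
  rw [pd_pd_eq hH, iteratedFDeriv_two_apply]
  simp

/-- The solid harmonics of degree `k`. -/
def harm (n k : ℕ) : Submodule ℝ (Amb n → ℝ) where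
  carrier := {H | ContDiff ℝ ∞ H ∧ IsHomog k H ∧ ∀ x, x ≠ 0 → ∑ i, pd i (pd i H) x = 0}
  zero_mem' := by
    refine ⟨contDiff_const, fun t _ x _ => by simp, fun x _ => ?_⟩
    have : ∀ i : Fin (n + 1), pd i (0 : Amb n → ℝ) = 0 := fun i => by
      ext y; simp [pd]
    simp [this]
  add_mem' := by
    rintro F G ⟨hF, hF', hF''⟩ ⟨hG, hG', hG''⟩
    refine ⟨hF.add hG, fun t ht x hx => ?_, fun x hx => ?_⟩
    · simp only [Pi.add_apply, hF' t ht x hx, hG' t ht x hx]; ring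
    · have h1 : ∀ i, pd i (F + G) = fun y => pd i F y + pd i G y := fun i => by
        ext y
        exact pd_add (hF.differentiable (by simp) y) (hG.differentiable (by simp) y)
      simp_rw [h1]
      simp_rw [pd_add ((contDiff_pd hF _).differentiable (by simp) x)
        ((contDiff_pd hG _).differentiable (by simp) x)]
      rw [Finset.sum_add_distrib, hF'' x hx, hG'' x hx, add_zero]
  smul_mem' := by
    rintro c F ⟨hF, hF', hF''⟩
    refine ⟨hF.const_smul c, fun t ht x hx => ?_, fun x hx => ?_⟩
    · simp only [Pi.smul_apply, smul_eq_mul, hF' t ht x hx]; ring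
    · have h1 : ∀ i, pd i (c • F) = fun y => c * pd i F y := fun i => by
        ext y
        exact pd_const_mul c (hF.differentiable (by simp) y)
      simp_rw [h1]
      simp_rw [pd_const_mul c ((contDiff_pd hF _).differentiable (by simp) x)]
      rw [← Finset.mul_sum, hF'' x hx, mul_zero]

section harm
variable {k l : ℕ} {H G : Amb n → ℝ}

lemma differentiableAt_of_mem_harm (hH : H ∈ harm n k) (x : Amb n) : DifferentiableAt ℝ H x :=
  hH.1.differentiable (by simp) x

lemma HomogC1.of_contDiff {m : ℝ} (hH : ContDiff ℝ ∞ H) (hm : IsHomog m H) : HomogC1 m H :=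
  ⟨fun _ _ => hH.contDiffAt.of_le (by exact_mod_cast le_top), hm⟩

lemma homogC1_of_mem_harm (hH : H ∈ harm n k) : HomogC1 k H := .of_contDiff hH.1 hH.2.1

lemma homogC1_pd_of_mem_harm (hH : H ∈ harm n k) (i : Fin (n + 1)) :
    HomogC1 ((k : ℝ) - 1) (pd i H) :=
  .of_contDiff (contDiff_pd hH.1 i) ((homogC1_of_mem_harm hH).pd_isHomog i)

lemma homogC1_pd_pd_of_mem_harm (hH : H ∈ harm n k) (i j : Fin (n + 1)) :
    HomogC1 ((k : ℝ) - 2) (pd i (pd j H)) :=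
  .of_contDiff (contDiff_pd (contDiff_pd hH.1 j) i)
    (by convert! (homogC1_pd_of_mem_harm hH j).pd_isHomog i using 1; ring)

lemma sum_pd_pd_pd_of_mem_harm (hH : H ∈ harm n k) (j : Fin (n + 1)) {x : Amb n} (hx : x ≠ 0) :
    ∑ i, pd i (pd i (pd j H)) x = 0 := by
  have h1 : ∀ i, pd i (pd i (pd j H)) = pd j (pd i (pd i H)) := fun i => by
    rw [pd_comm hH.1 i j, pd_comm (contDiff_pd hH.1 i) i j]
  simp_rw [h1]
  rw [← pd_sum (F := fun i => pd i (pd i H)) fun i _ =>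
    (contDiff_pd (contDiff_pd hH.1 i) i).differentiable (by simp) x]
  have : (fun y => ∑ i, pd i (pd i H) y) =ᶠ[nhds x] fun _ => 0 := by
    filter_upwards [isOpen_ne.mem_nhds hx] with y hy using hH.2.2 y hy
  rw [pd_congr this]
  simp [pd]

lemma pd_mem_harm (hH : H ∈ harm n (k + 1)) (i : Fin (n + 1)) : pd i H ∈ harm n k := by
  refine ⟨contDiff_pd hH.1 i, ?_, fun x hx => sum_pd_pd_pd_of_mem_harm hH i hx⟩
  have := (homogC1_of_mem_harm hH).pd_isHomog i
  simpa using this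

/-- In degree zero `H` is constant on each open ray, and continuity at the origin forces the same
value `H 0` on all of them. Smoothness at the origin is what excludes the other homogeneous harmonic
functions. -/
lemma eq_const_of_mem_harm_zero (hH : H ∈ harm n 0) (x : Amb n) : H x = H 0 := by
  rcases eq_or_ne x 0 with rfl | hx
  · rfl
  have hc : Filter.Tendsto (fun t : ℝ => H (t • x)) (nhdsWithin 0 (Set.Ioi 0)) (nhds (H 0)) := by
    have : Continuous fun t : ℝ => H (t • x) :=
      hH.1.continuous.comp (continuous_id.smul continuous_const)
    have h0 := this.tendsto 0
    rw [zero_smul] at h0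
    exact h0.mono_left nhdsWithin_le_nhds
  refine tendsto_nhds_unique (tendsto_const_nhds.congr' ?_) hc
  filter_upwards [self_mem_nhdsWithin] with t ht
  rw [hH.2.1 t ht x hx]; simp

lemma pd_eq_zero_of_mem_harm_zero (hH : H ∈ harm n 0) (i : Fin (n + 1)) : pd i H = 0 := by
  have : H = fun _ => H 0 := funext (eq_const_of_mem_harm_zero hH)
  rw [this]; ext x; simp [pd]

lemma const_mem_harm_zero (c : ℝ) : (fun _ : Amb n => c) ∈ harm n 0 := by
  refine ⟨contDiff_const, fun t _ x _ => by simp, fun x _ => ?_⟩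
  have : ∀ i : Fin (n + 1), pd i (fun _ : Amb n => c) = fun _ => 0 := fun i => by
    ext y; simp [pd]
  simp_rw [this]
  simp [pd]

lemma eq_zero_of_forall_ne (hH : H ∈ harm n k) (h : ∀ x, x ≠ 0 → H x = 0) : H = 0 :=
  (hH.1.continuous).ext_on (dense_compl_singleton (0 : Amb n)) continuous_const h

lemma eq_zero_of_forall_coe (hH : H ∈ harm n k) (h : ∀ ξ : Sph n, H ξ = 0) : H = 0 := by
  refine eq_zero_of_forall_ne hH fun x hx => ?_
  have h1 := h ⟨‖x‖⁻¹ • x, by simp [norm_smul, hx]⟩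
  rw [hH.2.1 _ (by positivity) x hx] at h1
  exact (mul_eq_zero.1 h1).resolve_left (by positivity)

/-- Induction on the degree: the gradient sends degree `k + 1` into `n + 1` copies of degree `k`,
and it is injective by Euler's identity. -/
instance finiteDimensional_harm (n k : ℕ) : FiniteDimensional ℝ (harm n k) := by
  induction k with
  | zero =>
    let f : harm n 0 →ₗ[ℝ] ℝ := (LinearMap.proj (0 : Amb n)).comp (harm n 0).subtype
    refine FiniteDimensional.of_injective f ?_
    rw [← LinearMap.ker_eq_bot, LinearMap.ker_eq_bot']
    rintro ⟨H, hH⟩ h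
    ext x
    exact (eq_const_of_mem_harm_zero hH x).trans h
  | succ k ih =>
    let f : harm n (k + 1) →ₗ[ℝ] (Fin (n + 1) → harm n k) :=
      { toFun := fun H i => ⟨pd i H, pd_mem_harm H.2 i⟩
        map_add' := fun F G => by
          ext i x
          exact pd_add (differentiableAt_of_mem_harm F.2 x) (differentiableAt_of_mem_harm G.2 x)
        map_smul' := fun c F => by
          ext i x
          exact pd_const_mul c (differentiableAt_of_mem_harm F.2 x) }
    refine FiniteDimensional.of_injective f ?_
    rw [← LinearMap.ker_eq_bot, LinearMap.ker_eq_bot']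
    rintro ⟨H, hH⟩ h
    refine Subtype.ext (eq_zero_of_forall_ne hH fun x hx => ?_)
    have he := (homogC1_of_mem_harm hH).euler hx
    have h0 : ∀ i, pd i H x = 0 := fun i =>
      congrFun (congrArg Subtype.val (congrFun h i)) x
    simp only [h0, mul_zero, Finset.sum_const_zero] at he
    refine (mul_eq_zero.1 he.symm).resolve_left ?_
    exact_mod_cast Nat.succ_ne_zero k

lemma pd_norm_sq (i : Fin (n + 1)) (x : Amb n) : pd i (fun y : Amb n => ‖y‖ ^ 2) x = 2 * x i := by
  rw [pd, (hasStrictFDerivAt_norm_sq x).hasFDerivAt.fderiv]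
  simp [EuclideanSpace.inner_single_right]

/-- Multiplication of a solid harmonic by a coordinate, made harmonic again. -/
lemma coord_mul_sub_mem_harm (hn : 2 ≤ n) (hH : H ∈ harm n k) (j : Fin (n + 1)) :
    (fun x => x j * H x - (2 * k + n - 1 : ℝ)⁻¹ * (‖x‖ ^ 2 * pd j H x)) ∈ harm n (k + 1) := by
  have hn' : (2 : ℝ) ≤ n := by exact_mod_cast hn
  -- The constant comes from `Δ(x_j H) = 2 ∂_j H` and `Δ(|x|² ∂_j H) = 2 (2k + n - 1) ∂_j H`.
  have hne : (2 * k + n - 1 : ℝ) ≠ 0 := by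
    have : (0 : ℝ) ≤ k := k.cast_nonneg
    linarith
  have hG : ContDiff ℝ ∞ (pd j H) := contDiff_pd hH.1 j
  have hcoord : ∀ i : Fin (n + 1), ContDiff ℝ ∞ (fun x : Amb n => x i) := fun i => by fun_prop
  have hsq : ContDiff ℝ ∞ (fun x : Amb n => ‖x‖ ^ 2) := contDiff_norm_sq ℝ
  have dc : ∀ (i : Fin (n + 1)) (x : Amb n), DifferentiableAt ℝ (fun x : Amb n => x i) x :=
    fun i x => (hcoord i).differentiable (by simp) x
  have dH := differentiableAt_of_mem_harm hH
  have dG : ∀ x, DifferentiableAt ℝ (pd j H) x := hG.differentiable (by simp)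
  have dS : ∀ x, DifferentiableAt ℝ (fun x : Amb n => ‖x‖ ^ 2) x := hsq.differentiable (by simp)
  have dpd : ∀ i x, DifferentiableAt ℝ (pd i H) x :=
    fun i => (contDiff_pd hH.1 i).differentiable (by simp)
  have dpdG : ∀ i x, DifferentiableAt ℝ (pd i (pd j H)) x :=
    fun i => (contDiff_pd hG i).differentiable (by simp)
  refine ⟨((hcoord j).mul hH.1).sub (contDiff_const.mul (hsq.mul hG)), ?_, fun x hx => ?_⟩
  · intro t ht x hx
    have h1 := hH.2.1 t ht x hx
    have h2 := (homogC1_of_mem_harm hH).pd_isHomog j t ht x hx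
    beta_reduce
    rw [h1, h2, norm_smul, Real.norm_of_nonneg ht.le]
    simp only [PiLp.smul_apply, smul_eq_mul]
    push_cast
    rw [Real.rpow_add_one ht.ne', Real.rpow_sub_one ht.ne']
    field_simp
  · have e1 : ∀ i, pd i (fun x => x j * H x - (2 * k + n - 1 : ℝ)⁻¹ * (‖x‖ ^ 2 * pd j H x)) =
        fun y => ((if i = j then 1 else 0) * H y + y j * pd i H y) - (2 * k + n - 1 : ℝ)⁻¹ *
          (2 * (y i * pd j H y) + ‖y‖ ^ 2 * pd i (pd j H) y) := by
      intro i
      ext y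
      rw [pd_sub ((dc j y).fun_mul (dH y)) (((dS y).fun_mul (dG y)).const_mul _),
        pd_mul (dc j y) (dH y), pd_const_mul _ ((dS y).fun_mul (dG y)), pd_mul (dS y) (dG y),
        pd_coord, pd_norm_sq]
      ring
    have e2 : ∀ i, pd i (fun y => ((if i = j then 1 else 0) * H y + y j * pd i H y) -
        (2 * k + n - 1 : ℝ)⁻¹ * (2 * (y i * pd j H y) + ‖y‖ ^ 2 * pd i (pd j H) y)) x =
        2 * ((if i = j then 1 else 0) * pd i H x) + x j * pd i (pd i H) x -
          (2 * k + n - 1 : ℝ)⁻¹ * (2 * pd j H x + 4 * (x i * pd i (pd j H) x) +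
            ‖x‖ ^ 2 * pd i (pd i (pd j H)) x) := by
      intro i
      have d1 := ((dH x).const_mul (if i = j then 1 else 0 : ℝ))
      have d2 := (dc j x).fun_mul (dpd i x)
      have d3 := ((dc i x).fun_mul (dG x)).const_mul 2
      have d4 := (dS x).fun_mul (dpdG i x)
      rw [pd_sub (d1.fun_add d2) ((d3.fun_add d4).const_mul _), pd_add d1 d2,
        pd_const_mul _ (dH x), pd_mul (dc j x) (dpd i x), pd_const_mul _ (d3.fun_add d4),
        pd_add d3 d4, pd_const_mul _ ((dc i x).fun_mul (dG x)), pd_mul (dc i x) (dG x),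
        pd_mul (dS x) (dpdG i x), pd_coord, pd_coord, pd_norm_sq]
      simp only [if_true]
      ring
    have he : ∑ i, x i * pd i (pd j H) x = ((k : ℝ) - 1) * pd j H x :=
      (homogC1_pd_of_mem_harm hH j).euler hx
    simp_rw [e1, e2]
    rw [Finset.sum_sub_distrib, Finset.sum_add_distrib, ← Finset.mul_sum, ← Finset.mul_sum,
      ← Finset.mul_sum, Finset.sum_add_distrib, Finset.sum_add_distrib, ← Finset.mul_sum,
      ← Finset.mul_sum, ← Finset.mul_sum, hH.2.2 x hx, sum_pd_pd_pd_of_mem_harm hH j hx, he]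
    simp only [ite_mul, one_mul, zero_mul, Finset.sum_ite_eq', Finset.mem_univ, if_true,
      Finset.sum_const, Finset.card_univ, Fintype.card_fin, nsmul_eq_mul]
    push_cast
    field_simp
    ring

lemma contMDiff_coe_of_mem_harm (hH : H ∈ harm n k) :
    ContMDiff (𝓡 n) 𝓘(ℝ, ℝ) ∞ (fun ξ : Sph n => H ξ) := by
  have := Fact.mk (@finrank_euclideanSpace_fin ℝ _ (n + 1))
  exact hH.1.contMDiff.comp contMDiff_coe_sphere

lemma homExt_coe {F : Amb n → ℝ} {m : ℝ} (hF : IsHomog m F) {x : Amb n} (hx : x ≠ 0) :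
    homExt (fun ξ : Sph n => F ξ) x = ‖x‖ ^ (-m) * F x := by
  have := hF ‖x‖⁻¹ (by positivity) x hx
  simp only [homExt, dif_neg hx, this, Real.inv_rpow (norm_nonneg x), Real.rpow_neg (norm_nonneg x)]

lemma pd_norm_rpow (m : ℝ) (i : Fin (n + 1)) {x : Amb n} (hx : x ≠ 0) :
    pd i (fun y : Amb n => ‖y‖ ^ m) x = m * ‖x‖ ^ (m - 2) * x i := by
  have hx' : 0 < ‖x‖ := norm_pos_iff.2 hx
  have hnd : DifferentiableAt ℝ (fun y : Amb n => ‖y‖) x :=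
    (contDiffAt_norm ℝ (n := 1) hx).differentiableAt (by norm_num)
  have h := hnd.hasFDerivAt.rpow_const (p := m) (Or.inl hx'.ne')
  have hpn := pd_norm i hx
  rw [pd] at hpn
  rw [pd, h.fderiv]
  simp only [smul_apply, hpn, smul_eq_mul]
  rw [Real.rpow_sub_one hx'.ne', show m - 2 = m - 1 - 1 by ring, Real.rpow_sub_one hx'.ne',
    Real.rpow_sub_one hx'.ne']
  field_simp

/-- Near the sphere the degree-zero extension of `H` is `|x|^(-k) H`; the product rule, Euler's
identity and `ΔH = 0` give its Laplacian at `|x| = 1`. -/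
lemma laplaceBeltrami_of_mem_harm (hH : H ∈ harm n k) (ξ : Sph n) :
    laplaceBeltrami (fun ζ : Sph n => H ζ) ξ = -(k * (k + n - 1) : ℝ) * H ξ := by
  set m : ℝ := -(k : ℝ) with hm
  have hξ := coe_ne_zero ξ
  have hev : homExt (fun ζ : Sph n => H ζ) =ᶠ[nhds (ξ : Amb n)] fun y => ‖y‖ ^ m * H y := by
    filter_upwards [isOpen_ne.mem_nhds hξ] with y hy using homExt_coe hH.2.1 hy
  have hC : ∀ (p : ℝ) (x : Amb n), x ≠ 0 → ContDiffAt ℝ 2 (fun y : Amb n => ‖y‖ ^ p) x :=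
    fun p x hx => (contDiffAt_norm ℝ hx).rpow_const_of_ne (norm_ne_zero_iff.2 hx)
  have hd : ∀ (p : ℝ) (x : Amb n), x ≠ 0 → DifferentiableAt ℝ (fun y : Amb n => ‖y‖ ^ p) x :=
    fun p x hx => (hC p x hx).differentiableAt (by norm_num)
  have dH := differentiableAt_of_mem_harm hH
  have dpd : ∀ i x, DifferentiableAt ℝ (pd i H) x :=
    fun i => (contDiff_pd hH.1 i).differentiable (by simp)
  have dc : ∀ (i : Fin (n + 1)) (x : Amb n), DifferentiableAt ℝ (fun x : Amb n => x i) x :=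
    fun i x => by fun_prop
  rw [laplaceBeltrami, (InnerProductSpace.laplacian_congr_nhds hev).eq_of_nhds,
    laplacian_eq_sum_pd ((hC m ξ hξ).mul (contDiff_infty.1 hH.1 2).contDiffAt)]
  have e1 : ∀ i, pd i (fun y => ‖y‖ ^ m * H y) =ᶠ[nhds (ξ : Amb n)]
      fun y => m * (‖y‖ ^ (m - 2) * (y i * H y)) + ‖y‖ ^ m * pd i H y := by
    intro i
    filter_upwards [isOpen_ne.mem_nhds hξ] with y hy
    rw [pd_mul (hd m y hy) (dH y), pd_norm_rpow m i hy]
    ring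
  have e2 : ∀ i, pd i (pd i (fun y => ‖y‖ ^ m * H y)) (ξ : Amb n) =
      m * (m - 2) * H ξ * ((ξ : Amb n) i * (ξ : Amb n) i) + m * H ξ +
        2 * m * ((ξ : Amb n) i * pd i H ξ) + pd i (pd i H) ξ := by
    intro i
    have d1 := (dc i (ξ : Amb n)).fun_mul (dH ξ)
    have d2 := (hd (m - 2) ξ hξ).fun_mul d1
    rw [pd_congr (e1 i), pd_add (d2.const_mul m) ((hd m ξ hξ).fun_mul (dpd i ξ)),
      pd_const_mul m d2, pd_mul (hd (m - 2) ξ hξ) d1, pd_mul (dc i (ξ : Amb n)) (dH ξ),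
      pd_mul (hd m ξ hξ) (dpd i ξ), pd_norm_rpow _ i hξ, pd_norm_rpow _ i hξ, pd_coord]
    simp only [norm_coe, Real.one_rpow, if_true]
    ring
  simp_rw [e2]
  rw [Finset.sum_add_distrib, Finset.sum_add_distrib, Finset.sum_add_distrib, ← Finset.mul_sum,
    Finset.sum_const, ← Finset.mul_sum, sum_coe_mul_self, (homogC1_of_mem_harm hH).euler hξ, hH.2.2 ξ hξ]
  simp only [Finset.card_univ, Fintype.card_fin, nsmul_eq_mul]
  rw [hm]
  push_cast
  ring

lemma isEigenfunction_of_mem_harm (hH : H ∈ harm n k) :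
    IsEigenfunction (k * (k + n - 1) : ℝ) (fun ξ : Sph n => H ξ) :=
  ⟨contMDiff_coe_of_mem_harm hH, fun ξ => by rw [laplaceBeltrami_of_mem_harm hH]; ring⟩

end harm

/-! ### Green's formula and orthogonality of different degrees -/

/-- The map `e` reads off the direction of differentiation, so the same formula serves vector fields
(`id`) and double sums over pairs of indices (`Prod.fst`). -/
lemma integral_sum_pd {ι : Type*} (s : Finset ι) (e : ι → Fin (n + 1)) {m : ℝ}
    {F : ι → Amb n → ℝ} (hF : ∀ i ∈ s, HomogC1 m (F i)) :
    ∫ ξ, ∑ i ∈ s, pd (e i) (F i) ξ ∂surf n =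
      (m + n) * ∫ ξ, ∑ i ∈ s, (ξ : Amb n) (e i) * F i ξ ∂surf n := by
  rw [integral_finsetSum _ fun i hi => integrable_surf ((hF i hi).continuous_coe_pd _),
    integral_finsetSum _ fun i hi =>
      integrable_surf (((homogC1_coord _).mul (hF i hi)).continuous_coe), Finset.mul_sum]
  exact Finset.sum_congr rfl fun i hi => integral_pd (hF i hi) _

/-- Green's formula for a homogeneous function and a solid harmonic. -/
lemma integral_grad_mul_grad {m : ℝ} {l : ℕ} {F H : Amb n → ℝ} (hF : HomogC1 m F)
    (hH : H ∈ harm n l) :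
    ∫ ξ, ∑ i, pd i F ξ * pd i H ξ ∂surf n = (m + l - 1 + n) * l * ∫ ξ, F ξ * H ξ ∂surf n := by
  have h := integral_sum_pd Finset.univ id (m := m + (l - 1)) (F := fun i x => F x * pd i H x)
    fun i _ => hF.mul (homogC1_pd_of_mem_harm hH i)
  have h1 : ∀ ξ : Sph n, ∑ i, pd (id i) (fun x => F x * pd i H x) ξ =
      ∑ i, pd i F ξ * pd i H ξ := by
    intro ξ
    have : ∀ i, pd (id i) (fun x => F x * pd i H x) ξ =
        pd i F ξ * pd i H ξ + F ξ * pd i (pd i H) ξ := fun i =>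
      pd_mul (hF.differentiableAt (coe_ne_zero ξ))
        ((contDiff_pd hH.1 i).differentiable (by simp) _)
    simp_rw [this]
    rw [Finset.sum_add_distrib, ← Finset.mul_sum, hH.2.2 ξ (coe_ne_zero ξ), mul_zero, add_zero]
  have h2 : ∀ ξ : Sph n, ∑ i, (ξ : Amb n) (id i) * (F ξ * pd i H ξ) = l * (F ξ * H ξ) := by
    intro ξ
    have := (homogC1_of_mem_harm hH).euler (coe_ne_zero ξ)
    calc ∑ i, (ξ : Amb n) (id i) * (F ξ * pd i H ξ) = F ξ * ∑ i, (ξ : Amb n) i * pd i H ξ := by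
          rw [Finset.mul_sum]; exact Finset.sum_congr rfl fun i _ => by simp only [id]; ring
      _ = _ := by rw [this]; ring
  simp_rw [h1, h2] at h
  rw [h, integral_const_mul]
  ring

/-- Green's formula evaluates the symmetric form `∫ ∇H · ∇G` with factor `l` or with factor `k`,
according to which of the two is taken as the harmonic; the difference is a nonzero multiple of `∫ H
G`. -/
lemma integral_harm_mul_harm (hn : 2 ≤ n) {k l : ℕ} (hkl : k ≠ l) {H G : Amb n → ℝ}
    (hH : H ∈ harm n k) (hG : G ∈ harm n l) : ∫ ξ : Sph n, H ξ * G ξ ∂surf n = 0 := by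
  have h1 := integral_grad_mul_grad (homogC1_of_mem_harm hH) hG
  have h2 := integral_grad_mul_grad (homogC1_of_mem_harm hG) hH
  have h3 : ∀ ξ : Sph n, ∑ i, pd i G ξ * pd i H ξ = ∑ i, pd i H ξ * pd i G ξ :=
    fun ξ => Finset.sum_congr rfl fun i _ => mul_comm _ _
  simp_rw [h3, mul_comm (G _)] at h2
  have h4 : ((k : ℝ) + l - 1 + n) * (l - k) * ∫ ξ : Sph n, H ξ * G ξ ∂surf n = 0 := by
    linear_combination h2 - h1
  have hn' : (2 : ℝ) ≤ n := by exact_mod_cast hn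
  have hc : ((k : ℝ) + l - 1 + n) ≠ 0 := by
    have : (0 : ℝ) ≤ k := k.cast_nonneg
    have : (0 : ℝ) ≤ l := l.cast_nonneg
    linarith
  have hd : ((l : ℝ) - k) ≠ 0 := sub_ne_zero.2 (by exact_mod_cast hkl.symm)
  exact (mul_eq_zero.1 h4).resolve_left (mul_ne_zero hc hd)

/-! ### `L²` theory: density of the spherical harmonics, expansions, Parseval -/

instance : (surf n).IsOpenPosMeasure := by unfold surf; infer_instance

lemma eq_zero_of_integral_mul_self {f : Sph n → ℝ} (hf : Continuous f)
    (h : ∫ ξ, f ξ * f ξ ∂surf n = 0) : f = 0 := by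
  have h1 := (integral_eq_zero_iff_of_nonneg (f := fun ξ => f ξ * f ξ)
    (fun ξ => mul_self_nonneg (f ξ)) (integrable_surf (hf.mul hf))).1 h
  have h2 := (Continuous.ae_eq_iff_eq (surf n) (hf.mul hf) continuous_const).1 h1
  ext ξ
  exact mul_self_eq_zero.1 (congrFun h2 ξ)

/-- The Cauchy-Schwarz inequality for continuous functions on the sphere. -/
lemma sq_integral_mul_le {f g : Sph n → ℝ} (hf : Continuous f) (hg : Continuous g) :
    (∫ ξ, f ξ * g ξ ∂surf n) ^ 2 ≤
      (∫ ξ, f ξ * f ξ ∂surf n) * ∫ ξ, g ξ * g ξ ∂surf n := by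
  have h : ∀ t : ℝ, 0 ≤ (∫ ξ, g ξ * g ξ ∂surf n) * (t * t) +
      (2 * ∫ ξ, f ξ * g ξ ∂surf n) * t + ∫ ξ, f ξ * f ξ ∂surf n := by
    intro t
    have h1 : 0 ≤ ∫ ξ, (f ξ + t * g ξ) * (f ξ + t * g ξ) ∂surf n :=
      integral_nonneg fun ξ => mul_self_nonneg _
    have h2 : ∀ ξ, (f ξ + t * g ξ) * (f ξ + t * g ξ) =
        (t * t) * (g ξ * g ξ) + (2 * t) * (f ξ * g ξ) + f ξ * f ξ := fun ξ => by ring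
    simp_rw [h2] at h1
    rw [integral_add (integrable_surf (by fun_prop)) (integrable_surf (by fun_prop)),
      integral_add (integrable_surf (by fun_prop)) (integrable_surf (by fun_prop)),
      integral_const_mul, integral_const_mul] at h1
    linarith
  have := discrim_le_zero h
  rw [discrim] at this
  linarith

lemma continuous_coe_of_mem_harm {k : ℕ} {H : Amb n → ℝ} (hH : H ∈ harm n k) :
    Continuous (fun ξ : Sph n => H ξ) :=
  hH.1.continuous.comp continuous_subtype_val

/-- The span of the spherical harmonics. -/
def harmSpan (n : ℕ) : Submodule ℝ C(Sph n, ℝ) :=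
  Submodule.span ℝ {f | ∃ k, ∃ H ∈ harm n k, ∀ ξ : Sph n, f ξ = H ξ}

/-- The coordinate functions on the sphere. -/
def coordMap (j : Fin (n + 1)) : C(Sph n, ℝ) := ⟨fun ξ => (ξ : Amb n) j, by fun_prop⟩

/-- On the sphere `|x|² = 1`, so `x_j H` is a harmonic of degree `k + 1` plus a multiple of `∂_j H`,
which has degree `k - 1` or vanishes. -/
lemma coordMap_mul_mem_harmSpan (hn : 2 ≤ n) (j : Fin (n + 1)) {f : C(Sph n, ℝ)}
    (hf : f ∈ harmSpan n) : coordMap j * f ∈ harmSpan n := by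
  induction hf using Submodule.span_induction with
  | zero => rw [mul_zero]; exact zero_mem _
  | add f g _ _ hf hg => rw [mul_add]; exact add_mem hf hg
  | smul c f _ hf => rw [mul_smul_comm]; exact Submodule.smul_mem _ c hf
  | mem f hf =>
    obtain ⟨k, H, hH, hfH⟩ := hf
    have hP := coord_mul_sub_mem_harm hn hH j
    let P : C(Sph n, ℝ) := ⟨_, continuous_coe_of_mem_harm hP⟩
    let G : C(Sph n, ℝ) := ⟨fun ξ => pd j H ξ,
      (contDiff_pd hH.1 j).continuous.comp continuous_subtype_val⟩
    have hPm : P ∈ harmSpan n := Submodule.subset_span ⟨k + 1, _, hP, fun _ => rfl⟩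
    have hGm : G ∈ harmSpan n := by
      cases k with
      | zero =>
        have : G = 0 := by
          ext ξ
          simp [G, pd_eq_zero_of_mem_harm_zero hH j]
        rw [this]; exact zero_mem _
      | succ k => exact Submodule.subset_span ⟨k, _, pd_mem_harm hH j, fun _ => rfl⟩
    have : coordMap j * f = P + (2 * k + n - 1 : ℝ)⁻¹ • G := by
      ext ξ
      simp [coordMap, P, G, hfH]
    rw [this]
    exact add_mem hPm (Submodule.smul_mem _ _ hGm)

/-- Stone-Weierstrass for the algebra generated by the coordinates. Its elements map the span of the
harmonics into itself by multiplication, and that span contains `1`. -/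
lemma exists_mem_harmSpan_near (hn : 2 ≤ n) {f : Sph n → ℝ} (hf : Continuous f) {ε : ℝ}
    (hε : 0 < ε) : ∃ g ∈ harmSpan n, ∀ ξ, |g ξ - f ξ| < ε := by
  let A : Subalgebra ℝ C(Sph n, ℝ) := Algebra.adjoin ℝ (Set.range coordMap)
  have hA : A.SeparatesPoints := by
    intro ξ ζ hne
    by_contra h
    push Not at h
    refine hne (Subtype.ext (PiLp.ext fun j => ?_))
    exact h _ ⟨coordMap j, Algebra.subset_adjoin ⟨j, rfl⟩, rfl⟩
  obtain ⟨g, hg⟩ := ContinuousMap.exists_mem_subalgebra_near_continuous_of_separatesPoints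
    A hA f hf ε hε
  refine ⟨g, ?_, hg⟩
  have key : ∀ p ∈ A, ∀ q ∈ harmSpan n, p * q ∈ harmSpan n := by
    intro p hp
    induction hp using Algebra.adjoin_induction with
    | mem p hp =>
      obtain ⟨j, rfl⟩ := hp
      exact fun q hq => coordMap_mul_mem_harmSpan hn j hq
    | algebraMap c =>
      intro q hq
      rw [← Algebra.smul_def]
      exact Submodule.smul_mem _ c hq
    | add p p' _ _ hp hp' => intro q hq; rw [add_mul]; exact add_mem (hp q hq) (hp' q hq)
    | mul p p' _ _ hp hp' => intro q hq; rw [mul_assoc]; exact hp _ (hp' q hq)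
  have h1 : (1 : C(Sph n, ℝ)) ∈ harmSpan n :=
    Submodule.subset_span ⟨0, _, const_mem_harm_zero 1, fun _ => rfl⟩
  simpa using key g g.2 1 h1

/-- `H k` is the component of `f` in the spherical harmonics of degree `k`. -/
structure HarmExpansion (f : Sph n → ℝ) (H : ℕ → Amb n → ℝ) : Prop where
  mem : ∀ k, H k ∈ harm n k
  proj : ∀ k, ∀ φ ∈ harm n k, ∫ ξ, f ξ * φ ξ ∂surf n = ∫ ξ : Sph n, H k ξ * φ ξ ∂surf n

/-- Riesz representation on the finite-dimensional space `harm n k`: the `L²` form is nondegenerate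
there, since a solid harmonic that vanishes on the sphere is zero. -/
lemma exists_harmExpansion {f : Sph n → ℝ} (hf : Continuous f) : ∃ H, HarmExpansion f H := by
  have key : ∀ k, ∃ H ∈ harm n k, ∀ φ ∈ harm n k,
      ∫ ξ, f ξ * φ ξ ∂surf n = ∫ ξ : Sph n, H ξ * φ ξ ∂surf n := by
    intro k
    have hc : ∀ H : harm n k, Continuous fun ξ : Sph n => (H : Amb n → ℝ) ξ :=
      fun H => continuous_coe_of_mem_harm H.2
    let T : harm n k →ₗ[ℝ] Module.Dual ℝ (harm n k) := LinearMap.mk₂ ℝ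
      (fun H φ => ∫ ξ : Sph n, (H : Amb n → ℝ) ξ * (φ : Amb n → ℝ) ξ ∂surf n)
      (fun H H' φ => by
        simp only [Submodule.coe_add, Pi.add_apply, add_mul]
        exact integral_add (integrable_surf ((hc H).mul (hc φ)))
          (integrable_surf ((hc H').mul (hc φ))))
      (fun c H φ => by
        simp only [Submodule.coe_smul, Pi.smul_apply, smul_eq_mul, mul_assoc]
        exact integral_const_mul c _)
      (fun H φ φ' => by
        simp only [Submodule.coe_add, Pi.add_apply, mul_add]
        exact integral_add (integrable_surf ((hc H).mul (hc φ)))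
          (integrable_surf ((hc H).mul (hc φ'))))
      (fun c H φ => by
        simp only [Submodule.coe_smul, Pi.smul_apply, smul_eq_mul, mul_left_comm]
        exact integral_const_mul c _)
    have hT : Function.Injective T := by
      rw [← LinearMap.ker_eq_bot, LinearMap.ker_eq_bot']
      intro H hH
      have h1 : ∫ ξ : Sph n, (H : Amb n → ℝ) ξ * (H : Amb n → ℝ) ξ ∂surf n = 0 :=
        LinearMap.congr_fun hH H
      exact Subtype.ext (eq_zero_of_forall_coe H.2
        (congrFun (eq_zero_of_integral_mul_self (hc H) h1)))
    have hs : Function.Surjective T :=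
      (LinearMap.injective_iff_surjective_of_finrank_eq_finrank
        (Subspace.dual_finrank_eq (K := ℝ) (V := harm n k)).symm).1 hT
    let L : Module.Dual ℝ (harm n k) :=
      { toFun := fun φ => ∫ ξ : Sph n, f ξ * (φ : Amb n → ℝ) ξ ∂surf n
        map_add' := fun φ φ' => by
          simp only [Submodule.coe_add, Pi.add_apply, mul_add]
          exact integral_add (integrable_surf (hf.mul (hc φ)))
            (integrable_surf (hf.mul (hc φ')))
        map_smul' := fun c φ => by
          simp only [Submodule.coe_smul, Pi.smul_apply, smul_eq_mul, mul_left_comm]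
          exact integral_const_mul c _ }
    obtain ⟨H, hH⟩ := hs L
    exact ⟨H, H.2, fun φ hφ => (LinearMap.congr_fun hH ⟨φ, hφ⟩).symm⟩
  choose H hH hH' using key
  exact ⟨H, hH, hH'⟩

namespace HarmExpansion
variable {f w : Sph n → ℝ} {H : ℕ → Amb n → ℝ}

lemma continuous_coe (h : HarmExpansion f H) (k : ℕ) : Continuous fun ξ : Sph n => H k ξ :=
  continuous_coe_of_mem_harm (h.mem k)

lemma integral_remainder_mul (h : HarmExpansion f H) (hf : Continuous f) (hw : Continuous w)
    (N : ℕ) : ∫ ξ, (f ξ - ∑ k ∈ Finset.range N, H k ξ) * w ξ ∂surf n =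
      ∫ ξ, f ξ * w ξ ∂surf n - ∑ k ∈ Finset.range N, ∫ ξ : Sph n, H k ξ * w ξ ∂surf n := by
  have hc := h.continuous_coe
  simp_rw [sub_mul, Finset.sum_mul]
  rw [integral_sub (integrable_surf (hf.fun_mul hw)) (integrable_surf
    (continuous_finsetSum _ fun k _ => (hc k).fun_mul hw)), integral_finsetSum]
  exact fun k _ => integrable_surf ((hc k).fun_mul hw)

lemma integral_remainder_mul_harm (h : HarmExpansion f H) (hn : 2 ≤ n) (hf : Continuous f)
    {l N : ℕ} (hlN : l < N) {φ : Amb n → ℝ} (hφ : φ ∈ harm n l) :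
    ∫ ξ, (f ξ - ∑ k ∈ Finset.range N, H k ξ) * φ ξ ∂surf n = 0 := by
  rw [h.integral_remainder_mul hf (continuous_coe_of_mem_harm hφ), h.proj l φ hφ,
    Finset.sum_eq_single_of_mem l (Finset.mem_range.2 hlN), sub_self]
  exact fun k _ hk => integral_harm_mul_harm hn hk (h.mem k) hφ

lemma eventually_integral_remainder_mul (h : HarmExpansion f H) (hn : 2 ≤ n) (hf : Continuous f)
    {g : C(Sph n, ℝ)} (hg : g ∈ harmSpan n) :
    ∀ᶠ N in Filter.atTop, ∫ ξ, (f ξ - ∑ k ∈ Finset.range N, H k ξ) * g ξ ∂surf n = 0 := by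
  have hr : ∀ N, Continuous fun ξ : Sph n => f ξ - ∑ k ∈ Finset.range N, H k ξ := fun N =>
    hf.sub (continuous_finsetSum _ fun k _ => h.continuous_coe k)
  induction hg using Submodule.span_induction with
  | zero => simp
  | add p q _ _ hp hq =>
    filter_upwards [hp, hq] with N h1 h2
    simp only [ContinuousMap.add_apply, mul_add]
    rw [integral_add (integrable_surf ((hr N).fun_mul p.continuous))
      (integrable_surf ((hr N).fun_mul q.continuous)), h1, h2, add_zero]
  | smul c p _ hp =>
    filter_upwards [hp] with N h1
    simp only [ContinuousMap.smul_apply, smul_eq_mul, mul_left_comm]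
    rw [integral_const_mul, h1, mul_zero]
  | mem p hp =>
    obtain ⟨l, φ, hφ, hpφ⟩ := hp
    filter_upwards [Filter.eventually_gt_atTop l] with N hN
    simp_rw [hpφ]
    exact h.integral_remainder_mul_harm hn hf hN hφ

/-- Bessel's inequality: the remainder `r` is orthogonal to the removed components, so `‖r‖² = ⟨r,
f⟩ ≤ ‖r‖ ‖f‖`. -/
lemma integral_remainder_sq_le (h : HarmExpansion f H) (hn : 2 ≤ n) (hf : Continuous f) (N : ℕ) :
    ∫ ξ, (f ξ - ∑ k ∈ Finset.range N, H k ξ) * (f ξ - ∑ k ∈ Finset.range N, H k ξ) ∂surf n ≤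
      ∫ ξ, f ξ * f ξ ∂surf n := by
  have hr : Continuous fun ξ : Sph n => f ξ - ∑ k ∈ Finset.range N, H k ξ :=
    hf.sub (continuous_finsetSum _ fun k _ => h.continuous_coe k)
  set r : Sph n → ℝ := fun ξ => f ξ - ∑ k ∈ Finset.range N, H k ξ with hrdef
  have h1 : ∫ ξ, r ξ * r ξ ∂surf n = ∫ ξ, r ξ * f ξ ∂surf n := by
    have : ∀ ξ, r ξ * r ξ = r ξ * f ξ - ∑ k ∈ Finset.range N, r ξ * H k ξ := fun ξ => by
      rw [← Finset.mul_sum, ← mul_sub]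
    simp_rw [this]
    rw [integral_sub (integrable_surf (hr.fun_mul hf)) (integrable_surf
      (continuous_finsetSum _ fun k _ => hr.fun_mul (h.continuous_coe k))),
      integral_finsetSum _ fun k _ => integrable_surf (hr.fun_mul (h.continuous_coe k)),
      Finset.sum_eq_zero, sub_zero]
    exact fun k hk => h.integral_remainder_mul_harm hn hf (Finset.mem_range.1 hk) (h.mem k)
  have h2 := sq_integral_mul_le hr hf
  change (∫ ξ, r ξ * f ξ ∂surf n) ^ 2 ≤ (∫ ξ, r ξ * r ξ ∂surf n) * _ at h2
  change ∫ ξ, r ξ * r ξ ∂surf n ≤ _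
  rw [← h1, sq] at h2
  have h3 : 0 ≤ ∫ ξ, r ξ * r ξ ∂surf n := integral_nonneg fun ξ => mul_self_nonneg _
  rcases h3.eq_or_lt with h0 | h0
  · rw [← h0]; exact integral_nonneg fun ξ => mul_self_nonneg _
  · exact le_of_mul_le_mul_left h2 h0

/-- Parseval's identity. -/
theorem tendsto_sum_integral (h : HarmExpansion f H) (hn : 2 ≤ n) (hf : Continuous f)
    (hw : Continuous w) : Filter.Tendsto
      (fun N => ∑ k ∈ Finset.range N, ∫ ξ : Sph n, H k ξ * w ξ ∂surf n) Filter.atTop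
      (nhds (∫ ξ, f ξ * w ξ ∂surf n)) := by
  rw [Metric.tendsto_atTop']
  intro δ hδ
  set M : ℝ := ∫ ξ, f ξ * f ξ ∂surf n with hM
  set A : ℝ := (surf n).real Set.univ with hA
  have hM0 : 0 ≤ M := integral_nonneg fun ξ => mul_self_nonneg _
  have hA0 : 0 ≤ A := measureReal_nonneg
  set ε : ℝ := δ / (M * A + 1) with hε
  have hMA : 0 ≤ M * A := mul_nonneg hM0 hA0
  have hε0 : 0 < ε := by positivity
  obtain ⟨g, hg, hgw⟩ := exists_mem_harmSpan_near hn hw hε0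
  obtain ⟨N₀, hN₀⟩ := Filter.eventually_atTop.1 (h.eventually_integral_remainder_mul hn hf hg)
  refine ⟨N₀, fun N hN => ?_⟩
  have hr : Continuous fun ξ : Sph n => f ξ - ∑ k ∈ Finset.range N, H k ξ :=
    hf.sub (continuous_finsetSum _ fun k _ => h.continuous_coe k)
  rw [dist_comm, Real.dist_eq, ← h.integral_remainder_mul hf hw N]
  -- For large `N` the remainder is orthogonal to `g`, so `w` may be replaced by the uniformly small
  -- `w - g`. Boundedness of the remainders in `L²` then suffices, and `ε` was chosen so that `M A
  -- ε² < δ²`.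
  have h1 : ∫ ξ, (f ξ - ∑ k ∈ Finset.range N, H k ξ) * w ξ ∂surf n =
      ∫ ξ, (f ξ - ∑ k ∈ Finset.range N, H k ξ) * (w ξ - g ξ) ∂surf n := by
    simp_rw [mul_sub]
    rw [integral_sub (integrable_surf (hr.fun_mul hw)) (integrable_surf (hr.fun_mul g.continuous)),
      hN₀ N hN.le, sub_zero]
  have h2 : ∫ ξ, (w ξ - g ξ) * (w ξ - g ξ) ∂surf n ≤ A * (ε * ε) := by
    have := integral_mono (μ := surf n) (f := fun ξ => (w ξ - g ξ) * (w ξ - g ξ))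
      (g := fun _ => ε * ε) (integrable_surf (by fun_prop)) (integrable_const _) (fun ξ => by
        have h3 := abs_lt.1 (hgw ξ)
        beta_reduce
        nlinarith)
    simpa [hA] using this
  have h3 := sq_integral_mul_le hr (hw.fun_sub g.continuous)
  have h4 := h.integral_remainder_sq_le hn hf N
  rw [h1]
  refine abs_lt_of_sq_lt_sq ?_ hδ.le
  calc _ ≤ _ := h3
    _ ≤ M * (A * (ε * ε)) := mul_le_mul h4 h2 (integral_nonneg fun ξ => mul_self_nonneg _) hM0
    _ = (M * A) * ε ^ 2 := by ring
    _ < (M * A + 1) ^ 2 * ε ^ 2 := by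
        have : 0 < ε ^ 2 := by positivity
        exact mul_lt_mul_of_pos_right (by nlinarith) this
    _ = δ ^ 2 := by
        rw [hε]; field_simp

/-- Each `‖H k‖²` equals `∫ H k · f`, a term of the convergent Parseval series. -/
lemma tendsto_integral_sq (h : HarmExpansion f H) (hn : 2 ≤ n) (hf : Continuous f) :
    Filter.Tendsto (fun k => ∫ ξ : Sph n, H k ξ * H k ξ ∂surf n) Filter.atTop (nhds 0) := by
  have h1 := h.tendsto_sum_integral hn hf hf
  have h2 := ((Filter.tendsto_add_atTop_iff_nat 1).2 h1).sub h1
  simp only [Finset.sum_range_succ, add_sub_cancel_left, sub_self] at h2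
  refine h2.congr fun k => ?_
  rw [← h.proj k _ (h.mem k)]
  exact integral_congr_ae (Filter.Eventually.of_forall fun ξ => mul_comm _ _)

end HarmExpansion

/-- The spherical harmonics are complete. -/
lemma eq_zero_of_forall_harm (hn : 2 ≤ n) {f : Sph n → ℝ} (hf : Continuous f)
    (h : ∀ k, ∀ φ ∈ harm n k, ∫ ξ, f ξ * φ ξ ∂surf n = 0) : f = 0 := by
  have hE : HarmExpansion f 0 := ⟨fun k => zero_mem _, fun k φ hφ => by simp [h k φ hφ]⟩
  have h1 := hE.tendsto_sum_integral hn hf hf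
  simp only [Pi.zero_apply, zero_mul, integral_zero, Finset.sum_const_zero] at h1
  exact eq_zero_of_integral_mul_self hf (tendsto_nhds_unique h1 tendsto_const_nhds)

/-! ### Conformal fields in homogeneous form and integration by parts along them -/

/-- A tangential vector field `V` on the sphere, extended homogeneously of degree one, that is
conformal with factor `ρ`. -/
structure ConformalData (V : Fin (n + 1) → Amb n → ℝ) (ρ : Sph n → ℝ) : Prop where
  homog : ∀ j, HomogC1 1 (V j)
  tangent : ∀ ξ : Sph n, ∑ j, (ξ : Amb n) j * V j ξ = 0
  conformal : ∀ (ξ : Sph n) (i j : Fin (n + 1)), pd i (V j) ξ + pd j (V i) ξ =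
    2 * ρ ξ * ((if i = j then 1 else 0) - (ξ : Amb n) i * (ξ : Amb n) j)

/-- The derivative of `F` along the vector field `V`. -/
def adv (V : Fin (n + 1) → Amb n → ℝ) (F : Amb n → ℝ) (x : Amb n) : ℝ := ∑ j, V j x * pd j F x

lemma adv_mul {V : Fin (n + 1) → Amb n → ℝ} {F G : Amb n → ℝ} {x : Amb n}
    (hF : DifferentiableAt ℝ F x) (hG : DifferentiableAt ℝ G x) :
    adv V (fun y => F y * G y) x = adv V F x * G x + F x * adv V G x := by
  simp only [adv, pd_mul hF hG, Finset.sum_mul, Finset.mul_sum, ← Finset.sum_add_distrib]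
  exact Finset.sum_congr rfl fun j _ => by ring

lemma sum_sum_mul_pd_pd_of_mem_harm {l : ℕ} {H : Amb n → ℝ} (hH : H ∈ harm n l) (ξ : Sph n) :
    ∑ i, ∑ j, (ξ : Amb n) i * (ξ : Amb n) j * pd i (pd j H) ξ = l * (l - 1) * H ξ := by
  have hξ := coe_ne_zero ξ
  rw [Finset.sum_comm]
  calc ∑ j, ∑ i, (ξ : Amb n) i * (ξ : Amb n) j * pd i (pd j H) ξ
      = ∑ j, (ξ : Amb n) j * ∑ i, (ξ : Amb n) i * pd i (pd j H) ξ := by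
        simp_rw [Finset.mul_sum]
        exact Finset.sum_congr rfl fun j _ => Finset.sum_congr rfl fun i _ => by ring
    _ = (l - 1) * ∑ j, (ξ : Amb n) j * pd j H ξ := by
        simp_rw [(homogC1_pd_of_mem_harm hH _).euler hξ, Finset.mul_sum]
        exact Finset.sum_congr rfl fun j _ => by ring
    _ = _ := by rw [(homogC1_of_mem_harm hH).euler hξ]; ring

namespace ConformalData
variable {V : Fin (n + 1) → Amb n → ℝ} {ρ : Sph n → ℝ}

lemma sum_pd (h : ConformalData V ρ) (ξ : Sph n) : ∑ i, pd i (V i) ξ = n * ρ ξ := by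
  have h1 : ∑ i, (pd i (V i) ξ + pd i (V i) ξ) =
      ∑ i : Fin (n + 1), (2 * ρ ξ - 2 * ρ ξ * ((ξ : Amb n) i * (ξ : Amb n) i)) :=
    Finset.sum_congr rfl fun i _ => by rw [h.conformal ξ i i]; simp; ring
  rw [Finset.sum_add_distrib, Finset.sum_sub_distrib, Finset.sum_const, ← Finset.mul_sum,
    sum_coe_mul_self] at h1
  simp only [Finset.card_univ, Fintype.card_fin, nsmul_eq_mul] at h1
  push_cast at h1
  linarith

/-- The factor is given as a mere function; the trace of the conformal equation exhibits it as `div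
V / n`. -/
lemma continuous_factor (h : ConformalData V ρ) (hn : 2 ≤ n) : Continuous ρ := by
  have hn' : (n : ℝ) ≠ 0 := by positivity
  have : ρ = fun ξ : Sph n => (n : ℝ)⁻¹ * ∑ i, pd i (V i) ξ := by
    ext ξ; rw [h.sum_pd]; field_simp
  rw [this]
  exact continuous_const.mul (continuous_finsetSum _ fun i _ => (h.homog i).continuous_coe_pd i)

lemma continuous_adv (h : ConformalData V ρ) {m : ℝ} {F : Amb n → ℝ} (hF : HomogC1 m F) :
    Continuous fun ξ : Sph n => adv V F ξ :=
  continuous_finsetSum _ fun j _ => ((h.homog j).continuous_coe).mul (hF.continuous_coe_pd j)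

/-- Against a symmetric `S` only the symmetric part of `∂V` counts, and the conformal equation
prescribes that part. -/
lemma sum_pd_mul_symm (h : ConformalData V ρ) (ξ : Sph n)
    {S : Fin (n + 1) → Fin (n + 1) → ℝ} (hS : ∀ i j, S i j = S j i) :
    ∑ i, ∑ j, pd i (V j) ξ * S i j =
      ρ ξ * (∑ i, S i i - ∑ i, ∑ j, (ξ : Amb n) i * (ξ : Amb n) j * S i j) := by
  have h1 : ∑ i, ∑ j, pd i (V j) ξ * S i j = ∑ i, ∑ j, pd j (V i) ξ * S i j := by
    rw [Finset.sum_comm]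
    exact Finset.sum_congr rfl fun i _ => Finset.sum_congr rfl fun j _ => by rw [hS]
  have h2 : ∑ i, ∑ j, (pd i (V j) ξ + pd j (V i) ξ) * S i j =
      2 * (ρ ξ * (∑ i, S i i - ∑ i, ∑ j, (ξ : Amb n) i * (ξ : Amb n) j * S i j)) := by
    have h3 : ∑ i, S i i = ∑ i, ∑ j, if i = j then S i j else 0 := by simp
    rw [h3, ← Finset.sum_sub_distrib, Finset.mul_sum, Finset.mul_sum]
    refine Finset.sum_congr rfl fun i _ => ?_
    rw [← Finset.sum_sub_distrib, Finset.mul_sum, Finset.mul_sum]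
    refine Finset.sum_congr rfl fun j _ => ?_
    rw [h.conformal]
    split_ifs <;> ring
  simp_rw [add_mul, Finset.sum_add_distrib] at h2
  linarith

/-- Integration by parts along the vector field. -/
lemma integral_adv (h : ConformalData V ρ) {m : ℝ} {F : Amb n → ℝ} (hF : HomogC1 m F)
    (hn : 2 ≤ n) :
    ∫ ξ : Sph n, adv V F ξ ∂surf n = -n * ∫ ξ, ρ ξ * F ξ ∂surf n := by
  have h0 := integral_sum_pd Finset.univ id (F := fun i x => F x * V i x)
    fun i _ => hF.mul (h.homog i)
  have h1 : ∀ ξ : Sph n, ∑ i, pd (id i) (fun x => F x * V i x) ξ =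
      adv V F ξ + n * (ρ ξ * F ξ) := by
    intro ξ
    have hξ := coe_ne_zero ξ
    simp_rw [id, pd_mul (hF.differentiableAt hξ) ((h.homog _).differentiableAt hξ),
      Finset.sum_add_distrib, ← Finset.mul_sum, h.sum_pd, adv, mul_comm (V _ _)]
    ring
  have h2 : ∀ ξ : Sph n, ∑ i, (ξ : Amb n) (id i) * (F ξ * V i ξ) = 0 := by
    intro ξ
    have := h.tangent ξ
    calc _ = F ξ * ∑ i, (ξ : Amb n) i * V i ξ := by
          rw [Finset.mul_sum]; exact Finset.sum_congr rfl fun i _ => by simp only [id]; ring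
      _ = 0 := by rw [this, mul_zero]
  simp_rw [h1, h2] at h0
  rw [integral_add (integrable_surf (h.continuous_adv hF)) (integrable_surf
    (continuous_const.fun_mul ((h.continuous_factor hn).fun_mul hF.continuous_coe))),
    integral_const_mul] at h0
  simp only [integral_zero, mul_zero] at h0
  linarith

section harm
variable {k l : ℕ} {G H : Amb n → ℝ}

lemma continuous_sum_hess (h : ConformalData V ρ) (hG : G ∈ harm n k) (hH : H ∈ harm n l) :
    Continuous fun ξ : Sph n => ∑ i, ∑ j, pd i G ξ * (V j ξ * pd i (pd j H) ξ) :=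
  continuous_finsetSum _ fun i _ => continuous_finsetSum _ fun j _ =>
    ((homogC1_of_mem_harm hG).continuous_coe_pd i).mul (((h.homog j).continuous_coe).mul
      (homogC1_pd_pd_of_mem_harm hH i j).continuous_coe)

lemma continuous_factor_mul_mul (h : ConformalData V ρ) (hn : 2 ≤ n) (hG : G ∈ harm n k)
    (hH : H ∈ harm n l) : Continuous fun ξ : Sph n => ρ ξ * (G ξ * H ξ) :=
  (h.continuous_factor hn).mul
    ((continuous_coe_of_mem_harm hG).mul (continuous_coe_of_mem_harm hH))

/-- The divergence theorem for `∑_j G V_j ∂_i ∂_j H`. The derivative of `V` meets the symmetric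
Hessian of `H` and yields only `ρ`; the third-order term is `V · ∇(ΔH) = 0`. -/
lemma integral_sum_hess (h : ConformalData V ρ) (hn : 2 ≤ n) (hG : G ∈ harm n k)
    (hH : H ∈ harm n l) :
    ∫ ξ : Sph n, ∑ i, ∑ j, pd i G ξ * (V j ξ * pd i (pd j H) ξ) ∂surf n =
      l * (l - 1) * ∫ ξ : Sph n, ρ ξ * (G ξ * H ξ) ∂surf n +
        (k + l - 1 + n) * (l - 1) * ∫ ξ : Sph n, G ξ * adv V H ξ ∂surf n := by
  have h0 := integral_sum_pd Finset.univ Prod.fst (m := k + (1 + (l - 2)))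
    (F := fun p : Fin (n + 1) × Fin (n + 1) => fun x => G x * (V p.2 x * pd p.1 (pd p.2 H) x))
    fun p _ => (homogC1_of_mem_harm hG).mul
      ((h.homog p.2).mul (homogC1_pd_pd_of_mem_harm hH p.1 p.2))
  simp_rw [Fintype.sum_prod_type] at h0
  have h1 : ∀ ξ : Sph n, ∑ i, ∑ j, pd i (fun x => G x * (V j x * pd i (pd j H) x)) ξ =
      ∑ i, ∑ j, pd i G ξ * (V j ξ * pd i (pd j H) ξ) +
        -(l * (l - 1)) * (ρ ξ * (G ξ * H ξ)) := by
    intro ξ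
    have hξ := coe_ne_zero ξ
    have dV := fun j => (h.homog j).differentiableAt hξ
    have dP : ∀ i j, DifferentiableAt ℝ (pd i (pd j H)) (ξ : Amb n) :=
      fun i j => (homogC1_pd_pd_of_mem_harm hH i j).differentiableAt hξ
    have e1 : ∀ i j, pd i (fun x => G x * (V j x * pd i (pd j H) x)) ξ =
        pd i G ξ * (V j ξ * pd i (pd j H) ξ) + G ξ * (pd i (V j) ξ * pd i (pd j H) ξ) +
          G ξ * (V j ξ * pd i (pd i (pd j H)) ξ) := by
      intro i j
      rw [pd_mul (differentiableAt_of_mem_harm hG _) ((dV j).fun_mul (dP i j)),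
        pd_mul (dV j) (dP i j)]
      ring
    have e2 : ∑ i, ∑ j, G ξ * (V j ξ * pd i (pd i (pd j H)) ξ) = 0 := by
      rw [Finset.sum_comm]
      refine Finset.sum_eq_zero fun j _ => ?_
      rw [← Finset.mul_sum, ← Finset.mul_sum, sum_pd_pd_pd_of_mem_harm hH j hξ, mul_zero, mul_zero]
    have e3 := h.sum_pd_mul_symm ξ (S := fun i j => pd i (pd j H) ξ)
      fun i j => by rw [pd_comm hH.1]
    simp_rw [e1, Finset.sum_add_distrib, e2, ← Finset.mul_sum]
    rw [e3, hH.2.2 ξ hξ, sum_sum_mul_pd_pd_of_mem_harm hH]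
    simp_rw [Finset.mul_sum]
    ring
  have h2 : ∀ ξ : Sph n, ∑ i, ∑ j, (ξ : Amb n) i * (G ξ * (V j ξ * pd i (pd j H) ξ)) =
      (l - 1) * (G ξ * adv V H ξ) := by
    intro ξ
    have hξ := coe_ne_zero ξ
    rw [Finset.sum_comm]
    calc _ = ∑ j, G ξ * V j ξ * ∑ i, (ξ : Amb n) i * pd i (pd j H) ξ := by
          simp_rw [Finset.mul_sum]
          exact Finset.sum_congr rfl fun j _ => Finset.sum_congr rfl fun i _ => by ring
      _ = _ := by
          simp_rw [(homogC1_pd_of_mem_harm hH _).euler hξ, adv, Finset.mul_sum]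
          exact Finset.sum_congr rfl fun j _ => by ring
  simp_rw [h1, h2] at h0
  rw [integral_add (integrable_surf (h.continuous_sum_hess hG hH)) (integrable_surf
    (continuous_const.fun_mul (h.continuous_factor_mul_mul hn hG hH))), integral_const_mul,
    integral_const_mul] at h0
  linear_combination h0

lemma continuous_sum_pd_mul (h : ConformalData V ρ) (hG : G ∈ harm n k) (hH : H ∈ harm n l) :
    Continuous fun ξ : Sph n => ∑ i, ∑ j, pd i (V j) ξ * (pd j H ξ * pd i G ξ) :=
  continuous_finsetSum _ fun i _ => continuous_finsetSum _ fun j _ =>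
    ((h.homog j).continuous_coe_pd i).mul (((homogC1_of_mem_harm hH).continuous_coe_pd j).mul
      ((homogC1_of_mem_harm hG).continuous_coe_pd i))

/-- The divergence theorem for the vector field `(V · ∇H) ∇G`, where `ΔG = 0`. Together with
`integral_sum_hess` it expresses the integral of `∂V` against `∇G ⊗ ∇H` through `∫ G (X H)` and `∫ ρ
G H`. -/
lemma integral_sum_pd_mul_add (h : ConformalData V ρ) (hG : G ∈ harm n k) (hH : H ∈ harm n l) :
    ∫ ξ : Sph n, ∑ i, ∑ j, pd i (V j) ξ * (pd j H ξ * pd i G ξ) ∂surf n +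
      ∫ ξ : Sph n, ∑ i, ∑ j, pd i G ξ * (V j ξ * pd i (pd j H) ξ) ∂surf n =
        (k + l - 1 + n) * k * ∫ ξ : Sph n, G ξ * adv V H ξ ∂surf n := by
  have h0 := integral_sum_pd Finset.univ Prod.fst (m := 1 + ((l - 1) + (k - 1)))
    (F := fun p : Fin (n + 1) × Fin (n + 1) => fun x => V p.2 x * (pd p.2 H x * pd p.1 G x))
    fun p _ => (h.homog p.2).mul
      ((homogC1_pd_of_mem_harm hH p.2).mul (homogC1_pd_of_mem_harm hG p.1))
  simp_rw [Fintype.sum_prod_type] at h0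
  have h1 : ∀ ξ : Sph n, ∑ i, ∑ j, pd i (fun x => V j x * (pd j H x * pd i G x)) ξ =
      ∑ i, ∑ j, pd i (V j) ξ * (pd j H ξ * pd i G ξ) +
        ∑ i, ∑ j, pd i G ξ * (V j ξ * pd i (pd j H) ξ) := by
    intro ξ
    have hξ := coe_ne_zero ξ
    have dV := fun j => (h.homog j).differentiableAt hξ
    have dG := fun i => (homogC1_pd_of_mem_harm hG i).differentiableAt hξ
    have dH := fun i => (homogC1_pd_of_mem_harm hH i).differentiableAt hξ
    have e1 : ∀ i j, pd i (fun x => V j x * (pd j H x * pd i G x)) ξ =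
        pd i (V j) ξ * (pd j H ξ * pd i G ξ) + pd i G ξ * (V j ξ * pd i (pd j H) ξ) +
          V j ξ * pd j H ξ * pd i (pd i G) ξ := by
      intro i j
      rw [pd_mul (dV j) ((dH j).fun_mul (dG i)), pd_mul (dH j) (dG i)]
      ring
    have e2 : ∑ i, ∑ j, V j ξ * pd j H ξ * pd i (pd i G) ξ = 0 := by
      rw [Finset.sum_comm]
      refine Finset.sum_eq_zero fun j _ => ?_
      rw [← Finset.mul_sum, hG.2.2 ξ hξ, mul_zero]
    simp_rw [e1, Finset.sum_add_distrib, e2, add_zero]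
  have h2 : ∀ ξ : Sph n, ∑ i, ∑ j, (ξ : Amb n) i * (V j ξ * (pd j H ξ * pd i G ξ)) =
      k * (G ξ * adv V H ξ) := by
    intro ξ
    calc _ = (∑ i, (ξ : Amb n) i * pd i G ξ) * adv V H ξ := by
          simp_rw [adv, Finset.sum_mul_sum]
          exact Finset.sum_congr rfl fun j _ => Finset.sum_congr rfl fun i _ => by ring
      _ = _ := by rw [(homogC1_of_mem_harm hG).euler (coe_ne_zero ξ)]; ring
  simp_rw [h1, h2] at h0
  rw [integral_add (integrable_surf (h.continuous_sum_pd_mul hG hH)) (integrable_surf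
    (h.continuous_sum_hess hG hH)), integral_const_mul] at h0
  linear_combination h0

lemma integral_mul_adv_add (h : ConformalData V ρ) (hn : 2 ≤ n) {m m' : ℝ} (hG : HomogC1 m G)
    (hH : HomogC1 m' H) :
    ∫ ξ : Sph n, G ξ * adv V H ξ ∂surf n + ∫ ξ : Sph n, H ξ * adv V G ξ ∂surf n =
      -n * ∫ ξ : Sph n, ρ ξ * (G ξ * H ξ) ∂surf n := by
  have h0 := h.integral_adv (hG.mul hH) hn
  have h1 : ∀ ξ : Sph n, adv V (fun x => G x * H x) ξ = G ξ * adv V H ξ + H ξ * adv V G ξ := by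
    intro ξ
    rw [adv_mul (hG.differentiableAt (coe_ne_zero ξ)) (hH.differentiableAt (coe_ne_zero ξ))]
    ring
  simp_rw [h1] at h0
  rwa [integral_add (integrable_surf (hG.continuous_coe.fun_mul (h.continuous_adv hH)))
    (integrable_surf (hH.continuous_coe.fun_mul (h.continuous_adv hG)))] at h0

/-- With `G = 1` the Hessian integral vanishes and `∫ X H = -n ∫ ρ H`, so `integral_sum_hess` reads
`(k - 1) (n - 1) (k + n) ∫ ρ H = 0`. -/
lemma integral_factor_mul_harm (h : ConformalData V ρ) (hn : 2 ≤ n) (hk : k ≠ 1)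
    (hH : H ∈ harm n k) : ∫ ξ : Sph n, ρ ξ * H ξ ∂surf n = 0 := by
  have h1 := h.integral_sum_hess hn (const_mem_harm_zero (n := n) 1) hH
  have h2 := h.integral_adv (homogC1_of_mem_harm hH) hn
  have h3 : ∀ i, pd i (fun _ : Amb n => (1 : ℝ)) = fun _ => 0 := fun i => by ext x; simp [pd]
  simp only [h3, zero_mul, Finset.sum_const_zero, integral_zero, one_mul, h2] at h1
  have h4 : ((k : ℝ) - 1) * ((n - 1) * (k + n)) * ∫ ξ : Sph n, ρ ξ * H ξ ∂surf n = 0 := by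
    push_cast at h1
    linear_combination h1
  have hn' : (2 : ℝ) ≤ n := by exact_mod_cast hn
  have hk' : (0 : ℝ) ≤ k := k.cast_nonneg
  have hk1 : (k : ℝ) - 1 ≠ 0 := sub_ne_zero.2 (by exact_mod_cast hk)
  exact (mul_eq_zero.1 h4).resolve_left
    (mul_ne_zero hk1 (mul_ne_zero (by linarith) (by linarith)))

/-- The conformal factor is a spherical harmonic of degree one. -/
lemma exists_factor_eq (h : ConformalData V ρ) (hn : 2 ≤ n) :
    ∃ P ∈ harm n 1, ∀ ξ : Sph n, ρ ξ = P ξ := by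
  have hρ := h.continuous_factor hn
  obtain ⟨P, hP⟩ := exists_harmExpansion hρ
  refine ⟨P 1, hP.mem 1, fun ξ => ?_⟩
  have h0 : (fun ξ : Sph n => ρ ξ - P 1 ξ) = 0 := by
    refine eq_zero_of_forall_harm hn (hρ.sub (hP.continuous_coe 1)) fun k φ hφ => ?_
    have hφc := continuous_coe_of_mem_harm hφ
    simp_rw [sub_mul]
    rw [integral_sub (integrable_surf (hρ.fun_mul hφc))
      (integrable_surf ((hP.continuous_coe 1).fun_mul hφc))]
    rcases eq_or_ne k 1 with rfl | hk
    · rw [hP.proj 1 φ hφ, sub_self]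
    · rw [h.integral_factor_mul_harm hn hk hφ, integral_harm_mul_harm hn hk.symm (hP.mem 1) hφ,
        sub_self]
  exact sub_eq_zero.1 (congrFun h0 ξ)

end harm
end ConformalData

/-! ### Matrix coefficients of a conformal field between spherical harmonics -/

section harm
variable {k l : ℕ} {G H P : Amb n → ℝ}

/-- On the sphere `ξ_j H` has components only in degrees `l + 1` and `l - 1`. -/
lemma integral_coord_mul_mul_harm (hn : 2 ≤ n) (hkl : k ≠ l + 1) (hlk : l ≠ k + 1)
    (hG : G ∈ harm n k) (hH : H ∈ harm n l) (j : Fin (n + 1)) :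
    ∫ ξ : Sph n, G ξ * ((ξ : Amb n) j * H ξ) ∂surf n = 0 := by
  have hP := coord_mul_sub_mem_harm hn hH j
  have h1 := integral_harm_mul_harm hn hkl hG hP
  have h2 : ∫ ξ : Sph n, G ξ * pd j H ξ ∂surf n = 0 := by
    cases l with
    | zero => simp [pd_eq_zero_of_mem_harm_zero hH j]
    | succ l => exact integral_harm_mul_harm hn (by omega) hG (pd_mem_harm hH j)
  have h3 : ∀ ξ : Sph n, G ξ * ((ξ : Amb n) j * H ξ) =
      G ξ * ((ξ : Amb n) j * H ξ - (2 * l + n - 1 : ℝ)⁻¹ * (‖(ξ : Amb n)‖ ^ 2 * pd j H ξ)) +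
        (2 * l + n - 1 : ℝ)⁻¹ * (G ξ * pd j H ξ) := by
    intro ξ; rw [norm_coe]; ring
  have hGc := continuous_coe_of_mem_harm hG
  simp_rw [h3]
  rw [integral_add (integrable_surf (hGc.fun_mul (continuous_coe_of_mem_harm hP)))
    (integrable_surf (continuous_const.fun_mul
      (hGc.fun_mul ((homogC1_of_mem_harm hH).continuous_coe_pd j)))), h1, integral_const_mul, h2,
    mul_zero, add_zero]

/-- Euler's identity makes a harmonic of degree one linear, because its partial derivatives are
constant. -/
lemma integral_harm_one_mul_mul (hn : 2 ≤ n) (hkl : k ≠ l + 1) (hlk : l ≠ k + 1)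
    (hP : P ∈ harm n 1) (hG : G ∈ harm n k) (hH : H ∈ harm n l) :
    ∫ ξ : Sph n, P ξ * (G ξ * H ξ) ∂surf n = 0 := by
  have h1 : ∀ ξ : Sph n, P ξ * (G ξ * H ξ) =
      ∑ j, pd j P 0 * (G ξ * ((ξ : Amb n) j * H ξ)) := by
    intro ξ
    have he := (homogC1_of_mem_harm hP).euler (coe_ne_zero ξ)
    simp_rw [fun j => eq_const_of_mem_harm_zero (pd_mem_harm hP j) (ξ : Amb n)] at he
    have he' : P ξ = ∑ j, (ξ : Amb n) j * pd j P 0 := by rw [he]; simp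
    rw [he', Finset.sum_mul]
    exact Finset.sum_congr rfl fun j _ => by ring
  simp_rw [h1]
  rw [integral_finsetSum _ fun j _ => integrable_surf (continuous_const.fun_mul
    ((continuous_coe_of_mem_harm hG).fun_mul ((homogC1_coord j).continuous_coe.fun_mul
      (continuous_coe_of_mem_harm hH))))]
  refine Finset.sum_eq_zero fun j _ => ?_
  rw [integral_const_mul, integral_coord_mul_mul_harm hn hkl hlk hG hH, mul_zero]

/-- Polarization: Green's formula for the pairs `(PG, H)` and `(PH, G)`, minus the one for `(GH,
P)`, isolates `2 P ∇G · ∇H`. -/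
lemma integral_harm_one_mul_grad (hP : P ∈ harm n 1) (hG : G ∈ harm n k) (hH : H ∈ harm n l) :
    2 * ∫ ξ : Sph n, P ξ * ∑ i, pd i G ξ * pd i H ξ ∂surf n =
      (k + l + n) * (k + l - 1) * ∫ ξ : Sph n, P ξ * (G ξ * H ξ) ∂surf n := by
  have hG1 := homogC1_of_mem_harm hG
  have hH1 := homogC1_of_mem_harm hH
  have hP1 := homogC1_of_mem_harm hP
  have c1 : ∀ {a b : ℕ} {A B : Amb n → ℝ}, A ∈ harm n a → B ∈ harm n b → Continuous fun ξ : Sph n =>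
      A ξ * ∑ i, pd i P ξ * pd i B ξ := fun hA hB =>
    (continuous_coe_of_mem_harm hA).mul (continuous_finsetSum _ fun i _ =>
      (hP1.continuous_coe_pd i).mul ((homogC1_of_mem_harm hB).continuous_coe_pd i))
  have c2 : Continuous fun ξ : Sph n => P ξ * ∑ i, pd i G ξ * pd i H ξ :=
    (continuous_coe_of_mem_harm hP).mul (continuous_finsetSum _ fun i _ =>
      (hG1.continuous_coe_pd i).mul (hH1.continuous_coe_pd i))
  have h1 := integral_grad_mul_grad (hG1.mul hH1) hP
  have h2 := integral_grad_mul_grad (hP1.mul hG1) hH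
  have h3 := integral_grad_mul_grad (hP1.mul hH1) hG
  have dG := differentiableAt_of_mem_harm hG
  have dH := differentiableAt_of_mem_harm hH
  have dP := differentiableAt_of_mem_harm hP
  have e1 : ∀ ξ : Sph n, ∑ i, pd i (fun x => G x * H x) ξ * pd i P ξ =
      H ξ * ∑ i, pd i P ξ * pd i G ξ + G ξ * ∑ i, pd i P ξ * pd i H ξ := by
    intro ξ
    simp_rw [Finset.mul_sum, ← Finset.sum_add_distrib, pd_mul (dG _) (dH _)]
    exact Finset.sum_congr rfl fun i _ => by ring
  have e2 : ∀ ξ : Sph n, ∑ i, pd i (fun x => P x * G x) ξ * pd i H ξ =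
      G ξ * ∑ i, pd i P ξ * pd i H ξ + P ξ * ∑ i, pd i G ξ * pd i H ξ := by
    intro ξ
    simp_rw [Finset.mul_sum, ← Finset.sum_add_distrib, pd_mul (dP _) (dG _)]
    exact Finset.sum_congr rfl fun i _ => by ring
  have e3 : ∀ ξ : Sph n, ∑ i, pd i (fun x => P x * H x) ξ * pd i G ξ =
      H ξ * ∑ i, pd i P ξ * pd i G ξ + P ξ * ∑ i, pd i G ξ * pd i H ξ := by
    intro ξ
    simp_rw [Finset.mul_sum, ← Finset.sum_add_distrib, pd_mul (dP _) (dH _)]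
    exact Finset.sum_congr rfl fun i _ => by ring
  have p1 : ∀ ξ : Sph n, G ξ * H ξ * P ξ = P ξ * (G ξ * H ξ) := fun ξ => by ring
  have p2 : ∀ ξ : Sph n, P ξ * G ξ * H ξ = P ξ * (G ξ * H ξ) := fun ξ => by ring
  have p3 : ∀ ξ : Sph n, P ξ * H ξ * G ξ = P ξ * (G ξ * H ξ) := fun ξ => by ring
  simp_rw [e1, p1] at h1
  simp_rw [e2, p2] at h2
  simp_rw [e3, p3] at h3
  rw [integral_add (integrable_surf (c1 hH hG)) (integrable_surf (c1 hG hH))] at h1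
  rw [integral_add (integrable_surf (c1 hG hH)) (integrable_surf c2)] at h2
  rw [integral_add (integrable_surf (c1 hH hG)) (integrable_surf c2)] at h3
  push_cast at h1 h2 h3
  linear_combination h2 + h3 - h1

end harm

namespace ConformalData
variable {V : Fin (n + 1) → Amb n → ℝ} {ρ : Sph n → ℝ} {k l : ℕ} {G H : Amb n → ℝ}

lemma integral_factor_mul_mul (h : ConformalData V ρ) (hn : 2 ≤ n) (hkl : k ≠ l + 1)
    (hlk : l ≠ k + 1) (hG : G ∈ harm n k) (hH : H ∈ harm n l) :
    ∫ ξ : Sph n, ρ ξ * (G ξ * H ξ) ∂surf n = 0 := by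
  obtain ⟨P, hP, hρ⟩ := h.exists_factor_eq hn
  simp_rw [hρ]
  exact integral_harm_one_mul_mul hn hkl hlk hP hG hH

/-- Adding the formulas for `∫ ∂V (∇G ⊗ ∇H)` to those with `G` and `H` exchanged leaves the
symmetric part of `∂V`, that is `ρ`. The resulting `∫ ρ ∇G · ∇H` is a multiple of `∫ ρ G H`, and `∫
H (X G)` is eliminated by `integral_mul_adv_add`. One linear equation for `∫ G (X H)` remains, which
determines it when `k ≠ l`. -/
lemma integral_mul_adv_relation (h : ConformalData V ρ) (hn : 2 ≤ n) (hG : G ∈ harm n k)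
    (hH : H ∈ harm n l) :
    (k + l - 1 + n) * (2 * (k - l) * ∫ ξ : Sph n, G ξ * adv V H ξ ∂surf n -
        n * (l - k + 1) * ∫ ξ : Sph n, ρ ξ * (G ξ * H ξ) ∂surf n) =
      (l * (l - 1) + k * (k - 1) - 2 * k * l + (k + l + n) * (k + l - 1)) *
        ∫ ξ : Sph n, ρ ξ * (G ξ * H ξ) ∂surf n := by
  obtain ⟨P, hP, hρ⟩ := h.exists_factor_eq hn
  have a1 := h.integral_sum_hess hn hG hH
  have a2 := h.integral_sum_hess hn hH hG
  have b1 := h.integral_sum_pd_mul_add hG hH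
  have b2 := h.integral_sum_pd_mul_add hH hG
  have q := h.integral_mul_adv_add hn (homogC1_of_mem_harm hG) (homogC1_of_mem_harm hH)
  have r := integral_harm_one_mul_grad hP hG hH
  have s : ∫ ξ : Sph n, ∑ i, ∑ j, pd i (V j) ξ * (pd j H ξ * pd i G ξ) ∂surf n +
      ∫ ξ : Sph n, ∑ i, ∑ j, pd i (V j) ξ * (pd j G ξ * pd i H ξ) ∂surf n =
      2 * ∫ ξ : Sph n, P ξ * ∑ i, pd i G ξ * pd i H ξ ∂surf n -
        2 * k * l * ∫ ξ : Sph n, P ξ * (G ξ * H ξ) ∂surf n := by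
    rw [← integral_add (integrable_surf (h.continuous_sum_pd_mul hG hH))
      (integrable_surf (h.continuous_sum_pd_mul hH hG)), ← integral_const_mul,
      ← integral_const_mul, ← integral_sub]
    · congr 1
      ext ξ
      have e := h.sum_pd_mul_symm ξ
        (S := fun i j => pd j H ξ * pd i G ξ + pd j G ξ * pd i H ξ) fun i j => by ring
      have e1 : ∑ i, ∑ j, (ξ : Amb n) i * (ξ : Amb n) j *
          (pd j H ξ * pd i G ξ + pd j G ξ * pd i H ξ) = 2 * k * l * (G ξ * H ξ) := by
        have hGe := (homogC1_of_mem_harm hG).euler (coe_ne_zero ξ)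
        have hHe := (homogC1_of_mem_harm hH).euler (coe_ne_zero ξ)
        calc _ = (∑ i, (ξ : Amb n) i * pd i G ξ) * (∑ j, (ξ : Amb n) j * pd j H ξ) +
            (∑ i, (ξ : Amb n) i * pd i H ξ) * (∑ j, (ξ : Amb n) j * pd j G ξ) := by
              simp_rw [Finset.sum_mul_sum, ← Finset.sum_add_distrib]
              exact Finset.sum_congr rfl fun j _ => Finset.sum_congr rfl fun i _ => by ring
          _ = _ := by rw [hGe, hHe]; ring
      rw [e1] at e
      simp only [mul_add, Finset.sum_add_distrib] at e ⊢
      rw [e, hρ]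
      simp_rw [mul_comm (pd _ H _)]
      ring
    · exact integrable_surf (continuous_const.fun_mul ((continuous_coe_of_mem_harm hP).fun_mul
        (continuous_finsetSum _ fun i _ => ((homogC1_of_mem_harm hG).continuous_coe_pd i).fun_mul
          ((homogC1_of_mem_harm hH).continuous_coe_pd i))))
    · exact integrable_surf (continuous_const.fun_mul ((continuous_coe_of_mem_harm hP).fun_mul
        ((continuous_coe_of_mem_harm hG).fun_mul (continuous_coe_of_mem_harm hH))))
  simp_rw [hρ] at *
  simp_rw [mul_comm (H _) (G _)] at *
  set I := ∫ ξ : Sph n, P ξ * (G ξ * H ξ) ∂surf n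
  set Q := ∫ ξ : Sph n, G ξ * adv V H ξ ∂surf n
  set Q' := ∫ ξ : Sph n, H ξ * adv V G ξ ∂surf n
  have q' : Q' = -n * I - Q := by linear_combination q
  rw [a1] at b1
  rw [a2] at b2
  rw [q'] at b2
  linear_combination s + r - b1 - b2

lemma integral_mul_adv_eq_zero (h : ConformalData V ρ) (hn : 2 ≤ n) (hne : k ≠ l)
    (hkl : k ≠ l + 1) (hlk : l ≠ k + 1) (hG : G ∈ harm n k) (hH : H ∈ harm n l) :
    ∫ ξ : Sph n, G ξ * adv V H ξ ∂surf n = 0 := by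
  have h1 := h.integral_mul_adv_relation hn hG hH
  rw [h.integral_factor_mul_mul hn hkl hlk hG hH] at h1
  have hn' : (2 : ℝ) ≤ n := by exact_mod_cast hn
  have h2 : ((k : ℝ) + l - 1 + n) * (k - l) ≠ 0 := by
    have : (0 : ℝ) ≤ k := k.cast_nonneg
    have : (0 : ℝ) ≤ l := l.cast_nonneg
    exact mul_ne_zero (by linarith) (sub_ne_zero.2 (by exact_mod_cast hne))
  refine (mul_eq_zero.1 (?_ : ((k : ℝ) + l - 1 + n) * (k - l) * _ = 0)).resolve_left h2
  linear_combination h1 / 2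

lemma integral_mul_adv_succ (h : ConformalData V ρ) (hn : 2 ≤ n) (hG : G ∈ harm n k)
    (hH : H ∈ harm n (k + 1)) :
    ∫ ξ : Sph n, G ξ * adv V H ξ ∂surf n =
      -(n + k) * ∫ ξ : Sph n, ρ ξ * (G ξ * H ξ) ∂surf n := by
  have h1 := h.integral_mul_adv_relation hn hG hH
  have hn' : (2 : ℝ) ≤ n := by exact_mod_cast hn
  have h2 : (2 * (k : ℝ) + n) ≠ 0 := by
    have : (0 : ℝ) ≤ k := k.cast_nonneg
    linarith
  push_cast at h1
  refine mul_left_cancel₀ h2 ?_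
  linear_combination -h1 / 2

end ConformalData

/-! ### Recursion of the eigenvalues and decay of the components -/

/-- For `μ = k (k + n - 1)` the expression under the root is the square of `k + (n - 1)/2`. -/
lemma symbolP_eq (hn : 2 ≤ n) (σ : ℝ) (k : ℕ) : symbolP n σ (k * (k + n - 1)) =
    Real.Gamma (k + n / 2 + σ) / Real.Gamma (k + n / 2 - σ) := by
  have hn' : (2 : ℝ) ≤ n := by exact_mod_cast hn
  have hk : (0 : ℝ) ≤ k := k.cast_nonneg
  have h : √((k * (k + n - 1) : ℝ) + (((n : ℝ) - 1) / 2) ^ 2) = k + (n - 1) / 2 := by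
    rw [show (k * (k + n - 1) : ℝ) + (((n : ℝ) - 1) / 2) ^ 2 = (k + (n - 1) / 2) ^ 2 by ring]
    exact Real.sqrt_sq (by linarith)
  rw [symbolP, h]
  ring_nf

/-- This is `Γ(x + 1) = x Γ(x)` in numerator and denominator, stated without division in the form
that the telescoping uses. -/
lemma symbolP_succ (hn : 2 ≤ n) {σ : ℝ} (hσ0 : 0 < σ) (hσ1 : σ < 1) (k : ℕ) :
    symbolP n σ (((k + 1 : ℕ) : ℝ) * (((k + 1 : ℕ) : ℝ) + n - 1)) * (k + n / 2 - σ) =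
      symbolP n σ (k * (k + n - 1)) * (k + n / 2 + σ) := by
  have hn' : (2 : ℝ) ≤ n := by exact_mod_cast hn
  have hk : (0 : ℝ) ≤ k := k.cast_nonneg
  rw [symbolP_eq hn, symbolP_eq hn]
  have h1 : (0 : ℝ) < k + n / 2 + σ := by linarith
  have h2 : (0 : ℝ) < k + n / 2 - σ := by linarith
  have e1 : (((k + 1 : ℕ) : ℝ) + n / 2 + σ) = (k + n / 2 + σ) + 1 := by push_cast; ring
  have e2 : (((k + 1 : ℕ) : ℝ) + n / 2 - σ) = (k + n / 2 - σ) + 1 := by push_cast; ring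
  rw [e1, e2, Real.Gamma_add_one h1.ne', Real.Gamma_add_one h2.ne']
  rw [div_mul_eq_mul_div, div_mul_eq_mul_div, div_eq_div_iff
    (mul_ne_zero h2.ne' (Real.Gamma_pos_of_pos h2).ne') (Real.Gamma_pos_of_pos h2).ne']
  ring

lemma exists_abs_le {ρ : Sph n → ℝ} (hρ : Continuous ρ) : ∃ C, 0 ≤ C ∧ ∀ ξ, |ρ ξ| ≤ C := by
  obtain ⟨C, hC⟩ := isCompact_univ.exists_bound_of_continuousOn hρ.continuousOn
  exact ⟨max C 0, le_max_right _ _, fun ξ => (hC ξ (Set.mem_univ ξ)).trans (le_max_left _ _)⟩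

/-- The decay of the spherical harmonic components of a `C¹` function. -/
lemma sq_mul_integral_sq_le (hn : 2 ≤ n) {F : Amb n → ℝ} (hF : HomogC1 0 F) {k : ℕ}
    {G : Amb n → ℝ} (hG : G ∈ harm n k)
    (hFG : ∫ ξ : Sph n, F ξ * G ξ ∂surf n = ∫ ξ : Sph n, G ξ * G ξ ∂surf n) :
    (k : ℝ) ^ 2 * ∫ ξ : Sph n, G ξ * G ξ ∂surf n ≤
      2 * ∫ ξ : Sph n, ∑ i, pd i F ξ * pd i F ξ ∂surf n := by
  have hG1 := homogC1_of_mem_harm hG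
  have h1 := integral_grad_mul_grad hF hG
  have h2 := integral_grad_mul_grad hG1 hG
  rw [hFG] at h1
  have cF : Continuous fun ξ : Sph n => ∑ i, pd i F ξ * pd i F ξ :=
    continuous_finsetSum _ fun i _ => (hF.continuous_coe_pd i).mul (hF.continuous_coe_pd i)
  have cG : Continuous fun ξ : Sph n => ∑ i, pd i G ξ * pd i G ξ :=
    continuous_finsetSum _ fun i _ => (hG1.continuous_coe_pd i).mul (hG1.continuous_coe_pd i)
  have cFG : Continuous fun ξ : Sph n => ∑ i, pd i F ξ * pd i G ξ :=
    continuous_finsetSum _ fun i _ => (hF.continuous_coe_pd i).mul (hG1.continuous_coe_pd i)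
  -- Young's inequality `ab ≤ a² + b²/4`. With both sides evaluated by Green's formula, the weight
  -- `1/4` leaves `k (2k + 3n - 3)/4` in front of `∫ G²`, which is at least `k²/2`.
  have h3 : ∫ ξ : Sph n, ∑ i, pd i F ξ * pd i G ξ ∂surf n ≤
      ∫ ξ : Sph n, (∑ i, pd i F ξ * pd i F ξ + 1 / 4 * ∑ i, pd i G ξ * pd i G ξ) ∂surf n := by
    refine integral_mono (integrable_surf cFG)
      (integrable_surf (cF.add (continuous_const.mul cG))) fun ξ => ?_
    beta_reduce
    rw [Finset.mul_sum, ← Finset.sum_add_distrib]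
    refine Finset.sum_le_sum fun i _ => ?_
    nlinarith [sq_nonneg (pd i F ξ - pd i G ξ / 2)]
  rw [integral_add (integrable_surf cF) (integrable_surf (continuous_const.fun_mul cG)),
    integral_const_mul, h1, h2] at h3
  set A := ∫ ξ : Sph n, G ξ * G ξ ∂surf n
  have hA : 0 ≤ A := integral_nonneg fun ξ => mul_self_nonneg _
  have hn' : (2 : ℝ) ≤ n := by exact_mod_cast hn
  have hk : (0 : ℝ) ≤ k := k.cast_nonneg
  have hkA : 0 ≤ k * A := mul_nonneg hk hA
  nlinarith [mul_nonneg hkA (by linarith : (0 : ℝ) ≤ n - 2)]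

/-! ### Infinitesimal conformal covariance of `P_σ` -/

namespace ConformalData
variable {V : Fin (n + 1) → Amb n → ℝ} {ρ : Sph n → ℝ} {k l : ℕ} {F G H : Amb n → ℝ}

/-- The pairing of `G` with the conformally weighted derivative of `F`. -/
lemma integral_mul_adv_add_factor (h : ConformalData V ρ) (hn : 2 ≤ n) {m m' : ℝ}
    (hG : HomogC1 m G) (hF : HomogC1 m' F) (κ : ℝ) :
    ∫ ξ : Sph n, G ξ * (adv V F ξ + κ * (ρ ξ * F ξ)) ∂surf n =
      ∫ ξ : Sph n, G ξ * adv V F ξ ∂surf n + κ * ∫ ξ : Sph n, ρ ξ * (G ξ * F ξ) ∂surf n := by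
  rw [← integral_const_mul, ← integral_add
    (integrable_surf (hG.continuous_coe.fun_mul (h.continuous_adv hF)))
    (integrable_surf (continuous_const.fun_mul ((h.continuous_factor hn).fun_mul
      (hG.continuous_coe.fun_mul hF.continuous_coe))))]
  congr 1; ext ξ; ring

/-- Moving the derivative from `F` to the smooth `G` allows Parseval's identity for `F` to be used
against a continuous function, with no termwise differentiation of the expansion. -/
lemma integral_mul_adjoint (h : ConformalData V ρ) (hn : 2 ≤ n) {m m' : ℝ} (hG : HomogC1 m G)
    (hF : HomogC1 m' F) (κ : ℝ) :
    ∫ ξ : Sph n, F ξ * (-adv V G ξ - (n - κ) * (ρ ξ * G ξ)) ∂surf n =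
      ∫ ξ : Sph n, G ξ * (adv V F ξ + κ * (ρ ξ * F ξ)) ∂surf n := by
  have h1 := h.integral_mul_adv_add hn hG hF
  have h2 : ∫ ξ : Sph n, F ξ * (-adv V G ξ - (n - κ) * (ρ ξ * G ξ)) ∂surf n =
      -∫ ξ : Sph n, F ξ * adv V G ξ ∂surf n -
        (n - κ) * ∫ ξ : Sph n, ρ ξ * (G ξ * F ξ) ∂surf n := by
    rw [← integral_const_mul, ← integral_neg, ← integral_sub
      (integrable_surf (hF.continuous_coe.fun_mul (h.continuous_adv hG)).fun_neg)
      (integrable_surf (continuous_const.fun_mul ((h.continuous_factor hn).fun_mul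
        (hG.continuous_coe.fun_mul hF.continuous_coe))))]
    congr 1; ext ξ; ring
  rw [h2, h.integral_mul_adv_add_factor hn hG hF]
  linear_combination -h1

lemma pairing_eq_zero (h : ConformalData V ρ) (hn : 2 ≤ n) (hne : k ≠ l) (hkl : k ≠ l + 1)
    (hlk : l ≠ k + 1) (hG : G ∈ harm n k) (hH : H ∈ harm n l) (κ : ℝ) :
    ∫ ξ : Sph n, G ξ * (adv V H ξ + κ * (ρ ξ * H ξ)) ∂surf n = 0 := by
  rw [h.integral_mul_adv_add_factor hn (homogC1_of_mem_harm hG) (homogC1_of_mem_harm hH),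
    h.integral_mul_adv_eq_zero hn hne hkl hlk hG hH, h.integral_factor_mul_mul hn hkl hlk hG hH]
  ring

/-- The derivative along the field is antisymmetric up to `-n ρ`, and `∫ ρ G²` vanishes by the
selection rule for degree-one factors. -/
lemma pairing_self (h : ConformalData V ρ) (hn : 2 ≤ n) (hG : G ∈ harm n k) (κ : ℝ) :
    ∫ ξ : Sph n, G ξ * (adv V G ξ + κ * (ρ ξ * G ξ)) ∂surf n = 0 := by
  have hG1 := homogC1_of_mem_harm hG
  have h1 := h.integral_mul_adv_add hn hG1 hG1
  have h2 := h.integral_factor_mul_mul hn (by omega) (by omega) hG hG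
  rw [h.integral_mul_adv_add_factor hn hG1 hG1, h2]
  rw [h2] at h1
  linarith

lemma pairing_succ (h : ConformalData V ρ) (hn : 2 ≤ n) (hG : G ∈ harm n k)
    (hH : H ∈ harm n (k + 1)) (σ : ℝ) :
    ∫ ξ : Sph n, G ξ * (adv V H ξ + ((n : ℝ) / 2 - σ) * (ρ ξ * H ξ)) ∂surf n =
      -(k + n / 2 + σ) * ∫ ξ : Sph n, ρ ξ * (G ξ * H ξ) ∂surf n := by
  rw [h.integral_mul_adv_add_factor hn (homogC1_of_mem_harm hG) (homogC1_of_mem_harm hH),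
    h.integral_mul_adv_succ hn hG hH]
  ring

lemma pairing_pred (h : ConformalData V ρ) (hn : 2 ≤ n) (hG : G ∈ harm n k)
    (hH : H ∈ harm n (k + 1)) (σ : ℝ) :
    ∫ ξ : Sph n, H ξ * (adv V G ξ + ((n : ℝ) / 2 - σ) * (ρ ξ * G ξ)) ∂surf n =
      (k + n / 2 - σ) * ∫ ξ : Sph n, ρ ξ * (G ξ * H ξ) ∂surf n := by
  have hG1 := homogC1_of_mem_harm hG
  have hH1 := homogC1_of_mem_harm hH
  have h1 := h.integral_mul_adv_add hn hG1 hH1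
  rw [h.integral_mul_adv_succ hn hG hH] at h1
  rw [h.integral_mul_adv_add_factor hn hH1 hG1]
  simp_rw [mul_comm (H _) (G _)]
  linear_combination h1

/-- The pairing with a component of `F` only sees the neighbouring components of `F`. -/
lemma pairing_eq_sum (h : ConformalData V ρ) (hn : 2 ≤ n) (hF : HomogC1 0 F)
    {E : ℕ → Amb n → ℝ} (hE : HarmExpansion (fun ξ : Sph n => F ξ) E) (κ : ℝ) (k : ℕ) :
    ∫ ξ : Sph n, E k ξ * (adv V F ξ + κ * (ρ ξ * F ξ)) ∂surf n =
      ∑ l ∈ Finset.range (k + 2),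
        ∫ ξ : Sph n, E k ξ * (adv V (E l) ξ + κ * (ρ ξ * E l ξ)) ∂surf n := by
  have hk := homogC1_of_mem_harm (hE.mem k)
  have hw : Continuous fun ξ : Sph n => -adv V (E k) ξ - (n - κ) * (ρ ξ * E k ξ) :=
    (h.continuous_adv hk).neg.sub
      (continuous_const.mul ((h.continuous_factor hn).mul hk.continuous_coe))
  have h1 := hE.tendsto_sum_integral hn hF.continuous_coe hw
  simp_rw [h.integral_mul_adjoint hn hk (homogC1_of_mem_harm (hE.mem _)),
    h.integral_mul_adjoint hn hk hF] at h1
  refine tendsto_nhds_unique h1 (tendsto_const_nhds.congr' ?_)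
  filter_upwards [Filter.eventually_ge_atTop (k + 2)] with N hN
  refine (Finset.eventually_constant_sum (fun l hl => ?_) hN).symm
  exact h.pairing_eq_zero hn (by omega) (by omega) (by omega) (hE.mem k) (hE.mem l) κ

/-- Telescoping: the degree `k` row has only the entries from degrees `k - 1` and `k + 1`. The
recursion for `lam` cancels the upper entry of one row against the lower entry of the next, so only
the last upper entry survives. -/
lemma sum_pairing_eq (h : ConformalData V ρ) (hn : 2 ≤ n) {σ : ℝ} {lam : ℕ → ℝ}
    (hlam : ∀ k : ℕ, lam (k + 1) * (k + n / 2 - σ) = lam k * (k + n / 2 + σ))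
    (hF : HomogC1 0 F) {E : ℕ → Amb n → ℝ} (hE : HarmExpansion (fun ξ : Sph n => F ξ) E) (N : ℕ) :
    ∑ k ∈ Finset.range (N + 1), lam k *
        ∫ ξ : Sph n, E k ξ * (adv V F ξ + ((n : ℝ) / 2 - σ) * (ρ ξ * F ξ)) ∂surf n =
      -(N + n / 2 + σ) * (lam N * ∫ ξ : Sph n, ρ ξ * (E N ξ * E (N + 1) ξ) ∂surf n) := by
  induction N with
  | zero =>
    rw [Finset.sum_range_one, h.pairing_eq_sum hn hF hE, Finset.sum_range_succ,
      Finset.sum_range_one, h.pairing_self hn (hE.mem 0),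
      h.pairing_succ hn (hE.mem 0) (hE.mem 1)]
    ring
  | succ N ih =>
    rw [Finset.sum_range_succ, ih, h.pairing_eq_sum hn hF hE, Finset.sum_range_succ,
      Finset.sum_range_succ, Finset.sum_range_succ, Finset.sum_eq_zero fun l hl => ?_,
      h.pairing_self hn (hE.mem (N + 1)), h.pairing_succ hn (hE.mem (N + 1)) (hE.mem (N + 2)),
      h.pairing_pred hn (hE.mem N) (hE.mem (N + 1))]
    · linear_combination
        (∫ ξ : Sph n, ρ ξ * (E N ξ * E (N + 1) ξ) ∂surf n) * hlam N
    · have := Finset.mem_range.1 hl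
      exact h.pairing_eq_zero hn (by omega) (by omega) (by omega) (hE.mem _) (hE.mem l) _

/-- By Cauchy-Schwarz the term is bounded by a constant times `‖lam N • E N‖ · (N + 1) ‖E (N + 1)‖`.
The first factor tends to zero as a component of the continuous `f`; the second is bounded by the
gradient of `F` (`sq_mul_integral_sq_le`). -/
lemma tendsto_boundary (h : ConformalData V ρ) (hn : 2 ≤ n) {σ : ℝ} (hσ0 : 0 < σ) (hσ1 : σ < 1)
    {lam : ℕ → ℝ} (hF : HomogC1 0 F) {E : ℕ → Amb n → ℝ}
    (hE : HarmExpansion (fun ξ : Sph n => F ξ) E) {f : Sph n → ℝ} (hf : Continuous f)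
    (hEf : HarmExpansion f fun k => lam k • E k) :
    Filter.Tendsto (fun N : ℕ => -((N : ℝ) + n / 2 + σ) *
      (lam N * ∫ ξ : Sph n, ρ ξ * (E N ξ * E (N + 1) ξ) ∂surf n)) Filter.atTop (nhds 0) := by
  have hn' : (2 : ℝ) ≤ n := by exact_mod_cast hn
  have hρ := h.continuous_factor hn
  obtain ⟨C, hC0, hC⟩ := exists_abs_le hρ
  set D := ∫ ξ : Sph n, ∑ i, pd i F ξ * pd i F ξ ∂surf n
  have h0 := (hEf.tendsto_integral_sq hn hf).const_mul (((n : ℝ) + 1) ^ 2 * C ^ 2 * (2 * D))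
  rw [mul_zero] at h0
  have h1 := (Real.continuous_sqrt.tendsto 0).comp h0
  rw [Real.sqrt_zero] at h1
  refine squeeze_zero_norm (fun N => ?_) h1
  rw [Real.norm_eq_abs]
  refine Real.abs_le_sqrt ?_
  have hN : (0 : ℝ) ≤ N := N.cast_nonneg
  have hc := hEf.continuous_coe N
  have hc1 := hE.continuous_coe (N + 1)
  have e1 : lam N * ∫ ξ : Sph n, ρ ξ * (E N ξ * E (N + 1) ξ) ∂surf n =
      ∫ ξ : Sph n, (ρ ξ * (lam N • E N) ξ) * E (N + 1) ξ ∂surf n := by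
    rw [← integral_const_mul]
    congr 1; ext ξ; simp only [Pi.smul_apply, smul_eq_mul]; ring
  have e2 := sq_integral_mul_le (hρ.fun_mul hc) hc1
  have e3 : ∫ ξ : Sph n, (ρ ξ * (lam N • E N) ξ) * (ρ ξ * (lam N • E N) ξ) ∂surf n ≤
      C ^ 2 * ∫ ξ : Sph n, (lam N • E N) ξ * (lam N • E N) ξ ∂surf n := by
    rw [← integral_const_mul]
    refine integral_mono (integrable_surf ((hρ.fun_mul hc).fun_mul (hρ.fun_mul hc)))
      (integrable_surf (continuous_const.fun_mul (hc.fun_mul hc))) fun ξ => ?_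
    have : ρ ξ ^ 2 ≤ C ^ 2 := sq_le_sq' (neg_le_of_abs_le (hC ξ)) (le_of_abs_le (hC ξ))
    have h2 := mul_le_mul_of_nonneg_right this (mul_self_nonneg ((lam N • E N) ξ))
    beta_reduce
    linarith
  have e4 := sq_mul_integral_sq_le hn hF (hE.mem (N + 1)) (hE.proj (N + 1) _ (hE.mem (N + 1)))
  have e5 : ((N : ℝ) + n / 2 + σ) ^ 2 ≤ ((n : ℝ) + 1) ^ 2 * ((N + 1 : ℕ) : ℝ) ^ 2 := by
    rw [← mul_pow]
    refine pow_le_pow_left₀ (by linarith) ?_ 2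
    push_cast
    nlinarith
  set A := ∫ ξ : Sph n, E (N + 1) ξ * E (N + 1) ξ ∂surf n
  set B := ∫ ξ : Sph n, (lam N • E N) ξ * (lam N • E N) ξ ∂surf n
  have hA : 0 ≤ A := integral_nonneg fun ξ => mul_self_nonneg _
  have hB : 0 ≤ B := integral_nonneg fun ξ => mul_self_nonneg _
  rw [e1, mul_pow, neg_sq]
  calc ((N : ℝ) + n / 2 + σ) ^ 2 * _
      ≤ (((n : ℝ) + 1) ^ 2 * ((N + 1 : ℕ) : ℝ) ^ 2) * ((C ^ 2 * B) * A) :=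
        mul_le_mul e5 (e2.trans (mul_le_mul_of_nonneg_right e3 hA)) (sq_nonneg _) (by positivity)
    _ = (((n : ℝ) + 1) ^ 2 * C ^ 2 * B) * (((N + 1 : ℕ) : ℝ) ^ 2 * A) := by ring
    _ ≤ (((n : ℝ) + 1) ^ 2 * C ^ 2 * B) * (2 * D) :=
        mul_le_mul_of_nonneg_left e4 (by positivity)
    _ = _ := by ring

/-- The infinitesimal conformal covariance of `P_σ`. -/
theorem integral_mul_conformal_eq_zero (h : ConformalData V ρ) (hn : 2 ≤ n) {σ : ℝ}
    (hσ0 : 0 < σ) (hσ1 : σ < 1) (hF : HomogC1 0 F) {f : Sph n → ℝ} (hf : Continuous f)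
    (hP : HasPsigma n σ (fun ξ => F ξ) f) :
    ∫ ξ : Sph n, f ξ * (adv V F ξ + ((n : ℝ) / 2 - σ) * (ρ ξ * F ξ)) ∂surf n = 0 := by
  obtain ⟨E, hE⟩ := exists_harmExpansion hF.continuous_coe
  set lam : ℕ → ℝ := fun k => symbolP n σ (k * (k + n - 1)) with hlam
  -- The equation `P_σ F = f`, tested on solid harmonics, says exactly that the components of `f`
  -- are `lam k • E k`.
  have hEf : HarmExpansion f fun k => lam k • E k := by
    refine ⟨fun k => Submodule.smul_mem _ _ (hE.mem k), fun k φ hφ => ?_⟩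
    rw [hP.2.2 _ _ (isEigenfunction_of_mem_harm hφ), hE.proj k φ hφ, ← integral_const_mul]
    congr 1; ext ξ; simp only [Pi.smul_apply, smul_eq_mul, hlam]; ring
  have hw : Continuous fun ξ : Sph n => adv V F ξ + ((n : ℝ) / 2 - σ) * (ρ ξ * F ξ) :=
    (h.continuous_adv hF).add
      (continuous_const.mul ((h.continuous_factor hn).mul hF.continuous_coe))
  have h1 := (Filter.tendsto_add_atTop_iff_nat 1).2 (hEf.tendsto_sum_integral hn hf hw)
  have h2 := h.tendsto_boundary hn hσ0 hσ1 hF hE hf hEf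
  refine tendsto_nhds_unique h1 (h2.congr fun N => ?_)
  rw [← h.sum_pairing_eq hn (fun k => symbolP_succ hn hσ0 hσ1 k) hF hE]
  refine Finset.sum_congr rfl fun k _ => ?_
  rw [← integral_const_mul]
  congr 1; ext ξ; simp only [Pi.smul_apply, smul_eq_mul]; ring

end ConformalData

/-! ### The Kazdan-Warner identity for homogeneous extensions -/

lemma HomogC1.rpow {F : Amb n → ℝ} (hF : HomogC1 0 F) (hpos : ∀ x, x ≠ 0 → 0 < F x) (q : ℝ) :
    HomogC1 0 (fun x => F x ^ q) where
  contDiffAt x hx := (hF.contDiffAt x hx).rpow_const_of_ne (hpos x hx).ne'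
  hom t ht x hx := by
    beta_reduce
    rw [hF.hom t ht x hx]; simp

lemma adv_rpow {V : Fin (n + 1) → Amb n → ℝ} {F : Amb n → ℝ} {x : Amb n}
    (hF : DifferentiableAt ℝ F x) (hx : F x ≠ 0) (q : ℝ) :
    adv V (fun y => F y ^ q) x = q * F x ^ (q - 1) * adv V F x := by
  have h : ∀ i, pd i (fun y => F y ^ q) x = q * F x ^ (q - 1) * pd i F x := fun i => by
    rw [pd, (hF.hasFDerivAt.rpow_const (Or.inl hx)).fderiv]
    simp [pd]
  simp_rw [adv, h, Finset.mul_sum]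
  exact Finset.sum_congr rfl fun i _ => by ring

/-- The Kazdan-Warner identity for homogeneous extensions. -/
theorem ConformalData.integral_adv_mul_rpow {V : Fin (n + 1) → Amb n → ℝ} {ρ : Sph n → ℝ}
    (h : ConformalData V ρ) (hn : 2 ≤ n) {σ : ℝ} (hσ0 : 0 < σ) (hσ1 : σ < 1) {F K : Amb n → ℝ}
    (hF : HomogC1 0 F) (hpos : ∀ x, x ≠ 0 → 0 < F x) (hK : HomogC1 0 K)
    (hP : HasPsigma n σ (fun ξ => F ξ)
      (fun ξ => K ξ * F ξ ^ (((n : ℝ) + 2 * σ) / ((n : ℝ) - 2 * σ)))) :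
    ∫ ξ : Sph n, adv V K ξ * F ξ ^ (2 * (n : ℝ) / ((n : ℝ) - 2 * σ)) ∂surf n = 0 := by
  have hn' : (2 : ℝ) ≤ n := by exact_mod_cast hn
  have hd : (n : ℝ) - 2 * σ ≠ 0 := by linarith
  set q : ℝ := 2 * (n : ℝ) / ((n : ℝ) - 2 * σ) with hq
  have hp : ((n : ℝ) + 2 * σ) / ((n : ℝ) - 2 * σ) = q - 1 := by
    rw [hq]; field_simp; ring
  -- The critical exponent enters here: the weight `n/2 - σ` times `q` is the `n` of the divergence
  -- formula, so the `ρ` terms cancel.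
  have hqn : q * ((n : ℝ) / 2 - σ) = n := by rw [hq]; field_simp
  rw [hp] at hP
  have hFq := hF.rpow hpos q
  have hfC := (hK.mul (hF.rpow hpos (q - 1))).continuous_coe
  have h1 := h.integral_mul_conformal_eq_zero hn hσ0 hσ1 hF hfC hP
  have h2 := h.integral_adv (hK.mul hFq) hn
  have cK : Continuous fun ξ : Sph n => adv V K ξ * F ξ ^ q :=
    (h.continuous_adv hK).mul hFq.continuous_coe
  have cF : Continuous fun ξ : Sph n => K ξ * F ξ ^ (q - 1) *
      (adv V F ξ + ((n : ℝ) / 2 - σ) * (ρ ξ * F ξ)) :=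
    hfC.mul ((h.continuous_adv hF).add
      (continuous_const.mul ((h.continuous_factor hn).mul hF.continuous_coe)))
  have cρ : Continuous fun ξ : Sph n => ρ ξ * (K ξ * F ξ ^ q) :=
    (h.continuous_factor hn).mul (hK.continuous_coe.mul hFq.continuous_coe)
  have e : ∀ ξ : Sph n, adv V (fun x => K x * F x ^ q) ξ = adv V K ξ * F ξ ^ q +
      q * (K ξ * F ξ ^ (q - 1) * (adv V F ξ + ((n : ℝ) / 2 - σ) * (ρ ξ * F ξ))) -
        n * (ρ ξ * (K ξ * F ξ ^ q)) := by
    intro ξ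
    have hξ := coe_ne_zero ξ
    have hpos' := hpos ξ hξ
    have e1 : F ξ ^ q = F ξ ^ (q - 1) * F ξ := by
      rw [← Real.rpow_add_one hpos'.ne']; ring_nf
    rw [adv_mul (hK.differentiableAt hξ) (hFq.differentiableAt hξ),
      adv_rpow (hF.differentiableAt hξ) hpos'.ne', e1]
    linear_combination -(K ξ * F ξ ^ (q - 1) * (ρ ξ * F ξ)) * hqn
  simp_rw [e] at h2
  rw [integral_sub (integrable_surf (cK.fun_add (continuous_const.fun_mul cF)))
    (integrable_surf (continuous_const.fun_mul cρ)), integral_add (integrable_surf cK)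
    (integrable_surf (continuous_const.fun_mul cF)), integral_const_mul, integral_const_mul,
    h1] at h2
  linarith

/-! ### From the intrinsic sphere to homogeneous extensions -/

lemma homExt_coe_eq (φ : Sph n → ℝ) (ξ : Sph n) : homExt φ ξ = φ ξ := by
  rw [homExt, dif_neg (coe_ne_zero ξ)]
  congr 1
  ext1
  simp

/-- Off the origin the extension is `φ` composed with the radial projection, which is smooth from
the open set `x ≠ 0` to the sphere. -/
lemma contDiffAt_homExt {m : ℕ∞ω} {φ : Sph n → ℝ} (hφ : ContMDiff (𝓡 n) 𝓘(ℝ, ℝ) m φ) {x : Amb n}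
    (hx : x ≠ 0) : ContDiffAt ℝ m (homExt φ) x := by
  have := Fact.mk (@finrank_euclideanSpace_fin ℝ _ (n + 1))
  let U : TopologicalSpace.Opens (Amb n) := ⟨{0}ᶜ, isOpen_compl_singleton⟩
  have hU : ∀ u : U, (u : Amb n) ≠ 0 := fun u => u.2
  have h1 : ContMDiff 𝓘(ℝ, Amb n) 𝓘(ℝ, Amb n) m
      (fun u : U => (fun y : Amb n => ‖y‖⁻¹ • y) (u : Amb n)) := by
    intro u
    exact contMDiffAt_subtype_iff.2 (((contDiffAt_norm ℝ (hU u)).inv (norm_ne_zero_iff.2 (hU u))).smul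
      contDiffAt_id).contMDiffAt
  have h2 : ∀ u : U, (fun y : Amb n => ‖y‖⁻¹ • y) (u : Amb n) ∈ Metric.sphere (0 : Amb n) 1 :=
    fun u => by simp [norm_smul, hU u]
  have h3 := hφ.comp (h1.codRestrict_sphere h2)
  have h4 : (φ ∘ Set.codRestrict _ _ h2) = fun u : U => homExt φ (u : Amb n) := by
    ext u
    rw [homExt, dif_neg (hU u)]
    rfl
  rw [h4] at h3
  exact (contMDiffAt_subtype_iff.1 (h3 ⟨x, hx⟩)).contDiffAt

lemma homogC1_homExt {φ : Sph n → ℝ} (hφ : ContMDiff (𝓡 n) 𝓘(ℝ, ℝ) 1 φ) :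
    HomogC1 0 (homExt φ) where
  contDiffAt _ hx := contDiffAt_homExt hφ hx
  hom t ht x hx := by
    rw [homExt, homExt, dif_neg hx, dif_neg (smul_ne_zero ht.ne' hx), Real.rpow_zero, one_mul]
    congr 1
    ext1
    simp only [norm_smul, Real.norm_of_nonneg ht.le, smul_smul]
    congr 1
    have := norm_ne_zero_iff.2 hx
    field_simp

lemma mdifferentiableAt_coe (ξ : Sph n) :
    MDifferentiableAt (𝓡 n) 𝓘(ℝ, Amb n) (fun ζ : Sph n => (ζ : Amb n)) ξ := by
  have := Fact.mk (@finrank_euclideanSpace_fin ℝ _ (n + 1))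
  exact (contMDiff_coe_sphere (m := 1) ξ).mdifferentiableAt one_ne_zero

lemma mfderiv_comp_coe {E' : Type*} [NormedAddCommGroup E'] [NormedSpace ℝ E'] {F : Amb n → E'}
    {φ : Sph n → E'} (hφ : ∀ ξ : Sph n, φ ξ = F ξ) {ξ : Sph n}
    (hF : DifferentiableAt ℝ F (ξ : Amb n)) (u : TangentSpace (𝓡 n) ξ) :
    mfderiv (𝓡 n) 𝓘(ℝ, E') φ ξ u = fderiv ℝ F (ξ : Amb n) (emb ξ u) := by
  have h : φ = F ∘ fun ζ : Sph n => (ζ : Amb n) := funext hφ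
  rw [h, mfderiv_comp ξ hF.mdifferentiableAt (mdifferentiableAt_coe ξ), mfderiv_eq_fderiv]
  rfl

lemma inner_coe_emb (ξ : Sph n) (u : TangentSpace (𝓡 n) ξ) :
    inner ℝ (ξ : Amb n) (emb ξ u) = 0 := by
  have := Fact.mk (@finrank_euclideanSpace_fin ℝ _ (n + 1))
  have h : emb ξ u ∈ (Submodule.span ℝ {(ξ : Amb n)})ᗮ :=
    range_mvfderiv_subtypeVal (E := Amb n) (n := n) ξ ▸ ⟨u, rfl⟩
  exact Submodule.mem_orthogonal_singleton_iff_inner_right.1 h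

lemma exists_emb_eq (ξ : Sph n) {w : Amb n} (hw : inner ℝ (ξ : Amb n) w = 0) :
    ∃ u : TangentSpace (𝓡 n) ξ, emb ξ u = w := by
  have := Fact.mk (@finrank_euclideanSpace_fin ℝ _ (n + 1))
  have h := Submodule.mem_orthogonal_singleton_iff_inner_right.2 hw
  rw [← range_mvfderiv_subtypeVal (E := Amb n) (n := n) ξ] at h
  exact h

/-- The map is the section `X` followed by the tangent map of the inclusion and the fibre projection
of the trivial tangent bundle of `ℝ^(n+1)`. -/
lemma contMDiff_emb {X : (ξ : Sph n) → TangentSpace (𝓡 n) ξ}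
    (hX : ContMDiff (𝓡 n) (𝓡 n).tangent ∞
      (fun ξ => (⟨ξ, X ξ⟩ : TangentBundle (𝓡 n) (Sph n)))) :
    ContMDiff (𝓡 n) 𝓘(ℝ, Amb n) 1 (fun ξ => emb ξ (X ξ)) := by
  have := Fact.mk (@finrank_euclideanSpace_fin ℝ _ (n + 1))
  have h1 : ContMDiff (𝓡 n).tangent 𝓘(ℝ, Amb n).tangent 1
      (tangentMap (𝓡 n) 𝓘(ℝ, Amb n) (fun ζ : Sph n => (ζ : Amb n))) :=
    (contMDiff_coe_sphere (m := 2)).contMDiff_tangentMap (by norm_num)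
  exact (contMDiff_snd_tangentBundle_modelSpace (Amb n) 𝓘(ℝ, Amb n)).comp
    (h1.comp (hX.of_le (by exact_mod_cast le_top)))

/-- A conformal Killing field gives conformal data by homogeneous extension. -/
lemma IsConformalKilling.exists_conformalData {X : (ξ : Sph n) → TangentSpace (𝓡 n) ξ}
    (hX : IsConformalKilling X) :
    ∃ V ρ, ConformalData V ρ ∧ ∀ (ξ : Sph n) j, V j ξ = emb ξ (X ξ) j := by
  obtain ⟨ρ, hρ⟩ := hX.conformal
  have hemb := contMDiff_emb hX.smooth
  let W : Fin (n + 1) → Amb n → ℝ := fun j => homExt fun ξ => emb ξ (X ξ) j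
  have hW : ∀ j, HomogC1 0 (W j) := fun j => homogC1_homExt
    ((EuclideanSpace.proj j : Amb n →L[ℝ] ℝ).contMDiff.comp hemb)
  have hWcoe : ∀ j (ξ : Sph n), W j ξ = emb ξ (X ξ) j := fun j ξ => homExt_coe_eq _ ξ
  have hnorm : HomogC1 1 fun x : Amb n => ‖x‖ := by simpa using homogC1_norm_rpow (n := n) 1
  have hV : ∀ j, HomogC1 1 fun x => ‖x‖ * W j x := fun j =>
    (hnorm.mul (hW j)).congr_degree (by ring)
  have htan : ∀ x : Amb n, x ≠ 0 → ∑ j, x j * W j x = 0 := by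
    intro x hx
    have h1 : ∀ j, W j x = W j (‖x‖⁻¹ • x) := fun j => by
      rw [(hW j).hom _ (by positivity) x hx]; simp
    let ζ : Sph n := ⟨‖x‖⁻¹ • x, by simp [norm_smul, hx]⟩
    have h2 := inner_coe_emb ζ (X ζ)
    rw [PiLp.inner_apply] at h2
    have h3 : ∀ j, (ζ : Amb n) j = ‖x‖⁻¹ * x j := fun j => rfl
    simp only [RCLike.inner_apply, conj_trivial, ← hWcoe, h3] at h2
    have h4 : ‖x‖⁻¹ * ∑ j, x j * W j x = 0 := by
      rw [Finset.mul_sum, ← h2]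
      refine Finset.sum_congr rfl fun j _ => ?_
      rw [h1 j]; ring
    exact (mul_eq_zero.1 h4).resolve_left (by positivity)
  refine ⟨fun j x => ‖x‖ * W j x, ρ, ⟨hV, fun ξ => ?_, fun ξ i j => ?_⟩, fun ξ j => ?_⟩
  · simpa [norm_coe] using htan ξ (coe_ne_zero ξ)
  · have hξ := coe_ne_zero ξ
    have dW := fun j => (hW j).differentiableAt hξ
    -- The factor `‖x‖` contributes `ξ_i W_j`. After symmetrization this equals the correction that
    -- appears in `hB` when the basis vectors are projected to the tangent space, which is why
    -- degree one is the right extension.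
    have hpdV : ∀ i j, pd i (fun x => ‖x‖ * W j x) ξ = (ξ : Amb n) i * W j ξ + pd i (W j) ξ := by
      intro i j
      rw [pd_mul (hnorm.differentiableAt hξ) (dW j), pd_norm i hξ, norm_coe]
      ring
    -- Differentiate the tangency relation `∑ x_l W_l = 0`.
    have hrad : ∀ i, ∑ l, (ξ : Amb n) l * pd i (W l) ξ = -W i ξ := by
      intro i
      have h1 : pd i (fun x => ∑ l, x l * W l x) (ξ : Amb n) = 0 := by
        have : (fun x : Amb n => ∑ l, x l * W l x) =ᶠ[nhds (ξ : Amb n)] fun _ => 0 := by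
          filter_upwards [isOpen_ne.mem_nhds hξ] with y hy using htan y hy
        rw [pd_congr this]; simp [pd]
      have dc : ∀ l : Fin (n + 1), DifferentiableAt ℝ (fun x : Amb n => x l) (ξ : Amb n) :=
        fun l => by fun_prop
      rw [pd_sum fun l _ => (dc l).fun_mul (dW l)] at h1
      simp_rw [pd_mul (dc _) (dW _), pd_coord, Finset.sum_add_distrib] at h1
      simp only [ite_mul, one_mul, zero_mul, Finset.sum_ite_eq, Finset.mem_univ, if_true] at h1
      linarith
    let Wv : Amb n → Amb n := fun x => WithLp.toLp 2 fun j => W j x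
    have hWv : DifferentiableAt ℝ Wv (ξ : Amb n) := by
      rw [differentiableAt_euclidean]
      exact dW
    have hWvc : ∀ (a : Amb n) l, (fderiv ℝ Wv (ξ : Amb n) a) l = ∑ i, a i * pd i (W l) ξ := by
      intro a l
      rw [← fderiv_apply_eq_sum_pd]
      have := ((EuclideanSpace.proj l : Amb n →L[ℝ] ℝ).hasFDerivAt.comp (ξ : Amb n)
        hWv.hasFDerivAt).fderiv
      exact (congrArg (fun L => L a) this).symm
    have hamb : ∀ u, ambDeriv X ξ u = fderiv ℝ Wv (ξ : Amb n) (emb ξ u) := fun u =>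
      mfderiv_comp_coe (fun ζ => by ext l; exact (hWcoe l ζ).symm) hWv u
    -- The tangential projections of the standard basis; testing the Lie derivative on all pairs of
    -- them recovers the conformal equation in ambient coordinates.
    let a : Fin (n + 1) → Amb n := fun i =>
      EuclideanSpace.single i 1 - (ξ : Amb n) i • (ξ : Amb n)
    have ha : ∀ i, inner ℝ (ξ : Amb n) (a i) = 0 := by
      intro i
      simp only [a, inner_sub_right, inner_smul_right, EuclideanSpace.inner_single_right,
        real_inner_self_eq_norm_sq, norm_coe]
      simp
    choose u hu using fun i => exists_emb_eq ξ (ha i)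
    have hac : ∀ i l, a i l = (if i = l then 1 else 0) - (ξ : Amb n) i * (ξ : Amb n) l := by
      intro i l
      simp [a, eq_comm]
    have hB : ∀ i j, inner ℝ (ambDeriv X ξ (u i)) (a j) =
        pd i (W j) ξ + (ξ : Amb n) j * W i ξ := by
      intro i j
      have h1 : ∀ l, ∑ i', a i i' * pd i' (W l) ξ = pd i (W l) ξ := by
        intro l
        have he := (hW l).euler hξ
        simp_rw [hac, sub_mul, Finset.sum_sub_distrib, mul_assoc, ← Finset.mul_sum, he]
        simp
      rw [hamb, hu, PiLp.inner_apply]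
      simp only [RCLike.inner_apply, conj_trivial, hWvc, h1]
      have h2 := hrad i
      simp_rw [hac, sub_mul, Finset.sum_sub_distrib, mul_assoc, ← Finset.mul_sum, h2]
      simp
    have hl := hρ ξ (u i) (u j)
    have haa : inner ℝ (a i) (a j) =
        (if i = j then 1 else 0) - (ξ : Amb n) i * (ξ : Amb n) j := by
      conv_lhs => rw [show a j = EuclideanSpace.single j 1 - (ξ : Amb n) j • (ξ : Amb n) from rfl]
      rw [inner_sub_right, inner_smul_right, real_inner_comm, real_inner_comm (ξ : Amb n), ha i]
      simp [EuclideanSpace.inner_single_left, hac]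
    simp only [lieRoundMetric, roundMetric, hu] at hl
    rw [real_inner_comm (ambDeriv X ξ (u j)) (a i), hB, hB, haa] at hl
    rw [hpdV, hpdV]
    linarith
  · simp [hWcoe]

/-! ### The coordinate gradient field and nonexistence -/

/-- The conformal vector field given by the gradient of a coordinate function. -/
lemma conformalData_coord (i : Fin (n + 1)) :
    ConformalData (fun j x => ‖x‖ ^ (1 : ℝ) * (if j = i then 1 else 0) -
      ‖x‖ ^ (-1 : ℝ) * (x i * x j)) (fun ξ : Sph n => -(ξ : Amb n) i) := by
  have hc : ∀ j : Fin (n + 1), HomogC1 0 fun _ : Amb n => (if j = i then (1 : ℝ) else 0) :=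
    fun j => ⟨fun x _ => contDiffAt_const, fun t _ x _ => by simp⟩
  have h1 : ∀ j, HomogC1 1 fun x : Amb n => ‖x‖ ^ (1 : ℝ) * (if j = i then 1 else 0) :=
    fun j => ((homogC1_norm_rpow 1).mul (hc j)).congr_degree (by ring)
  have h2 : ∀ j, HomogC1 1 fun x : Amb n => ‖x‖ ^ (-1 : ℝ) * (x i * x j) := fun j =>
    ((homogC1_norm_rpow (-1)).mul ((homogC1_coord i).mul (homogC1_coord j))).congr_degree
      (by norm_num)
  refine ⟨fun j => ?_, fun ξ => ?_, fun ξ k j => ?_⟩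
  · exact ⟨fun x hx => ((h1 j).contDiffAt x hx).sub ((h2 j).contDiffAt x hx), fun t ht x hx => by
      beta_reduce
      have e1 := (h1 j).hom t ht x hx
      have e2 := (h2 j).hom t ht x hx
      beta_reduce at e1 e2
      rw [e1, e2]; ring⟩
  · simp only [norm_coe, Real.one_rpow, one_mul, mul_sub, Finset.sum_sub_distrib]
    have : ∑ j, (ξ : Amb n) j * ((ξ : Amb n) i * (ξ : Amb n) j) = (ξ : Amb n) i := by
      calc _ = (ξ : Amb n) i * ∑ j, (ξ : Amb n) j * (ξ : Amb n) j := by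
            rw [Finset.mul_sum]; exact Finset.sum_congr rfl fun j _ => by ring
        _ = _ := by rw [sum_coe_mul_self, mul_one]
    rw [this]; simp
  · have hξ := coe_ne_zero ξ
    have dc : ∀ l : Fin (n + 1), DifferentiableAt ℝ (fun x : Amb n => x l) (ξ : Amb n) :=
      fun l => by fun_prop
    have dn : ∀ m : ℝ, DifferentiableAt ℝ (fun x : Amb n => ‖x‖ ^ m) (ξ : Amb n) :=
      fun m => (homogC1_norm_rpow m).differentiableAt hξ
    have e : ∀ k j, pd k (fun x : Amb n => ‖x‖ ^ (1 : ℝ) * (if j = i then 1 else 0) -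
        ‖x‖ ^ (-1 : ℝ) * (x i * x j)) ξ = (ξ : Amb n) k * (if j = i then 1 else 0) -
        (-(ξ : Amb n) k * ((ξ : Amb n) i * (ξ : Amb n) j) +
          ((if k = i then 1 else 0) * (ξ : Amb n) j + (ξ : Amb n) i * (if k = j then 1 else 0))) := by
      intro k j
      rw [pd_sub ((h1 j).differentiableAt hξ) ((h2 j).differentiableAt hξ),
        pd_mul (dn 1) ((hc j).differentiableAt hξ), pd_mul (dn (-1)) ((dc i).fun_mul (dc j)),
        pd_mul (dc i) (dc j), pd_norm_rpow _ _ hξ, pd_norm_rpow _ _ hξ, pd_coord, pd_coord]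
      simp [pd]
    rw [e, e]
    rw [show (if j = k then (1 : ℝ) else 0) = if k = j then 1 else 0 by simp [eq_comm]]
    ring

/-- A positive solution gives a homogeneous extension to which the identity applies. -/
lemma IsPositiveSolution.integral_adv_eq_zero (hn : 2 ≤ n) {σ : ℝ} (hσ0 : 0 < σ) (hσ1 : σ < 1)
    {K : Amb n → ℝ} {k v : Sph n → ℝ} (hv : IsPositiveSolution n σ k v) (hK : HomogC1 0 K)
    (hk : ∀ ξ : Sph n, k ξ = K ξ) {V : Fin (n + 1) → Amb n → ℝ} {ρ : Sph n → ℝ}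
    (h : ConformalData V ρ) :
    ∫ ξ : Sph n, adv V K ξ * v ξ ^ (2 * (n : ℝ) / ((n : ℝ) - 2 * σ)) ∂surf n = 0 := by
  have hF : HomogC1 0 (homExt v) := homogC1_homExt (hv.contMDiff.of_le (by norm_num))
  have hpos : ∀ x : Amb n, x ≠ 0 → 0 < homExt v x := fun x hx => by
    rw [homExt, dif_neg hx]; exact hv.pos _
  have hP := hv.eqn
  simp_rw [hk] at hP
  have h1 := h.integral_adv_mul_rpow hn hσ0 hσ1 hF hpos hK (by simpa only [homExt_coe_eq] using hP)
  simpa only [homExt_coe_eq] using h1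

lemma IsPositiveSolution.integral_dirDeriv_eq_zero (hn : 2 ≤ n) {σ : ℝ} (hσ0 : 0 < σ)
    (hσ1 : σ < 1) {K v : Sph n → ℝ} (hv : IsPositiveSolution n σ K v)
    (hK : ContMDiff (𝓡 n) 𝓘(ℝ, ℝ) 1 K) {X : (ξ : Sph n) → TangentSpace (𝓡 n) ξ}
    (hX : IsConformalKilling X) :
    ∫ ξ, dirDeriv X K ξ * v ξ ^ (2 * (n : ℝ) / ((n : ℝ) - 2 * σ)) ∂surf n = 0 := by
  obtain ⟨V, ρ, hV, hVX⟩ := hX.exists_conformalData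
  have hKh := homogC1_homExt hK
  have h1 : ∀ ξ, dirDeriv X K ξ = adv V (homExt K) ξ := fun ξ => by
    rw [dirDeriv, mfderiv_comp_coe (fun ζ => (homExt_coe_eq K ζ).symm)
      (hKh.differentiableAt (coe_ne_zero ξ)), fderiv_apply_eq_sum_pd, adv]
    simp_rw [hVX]
  simp_rw [h1]
  exact hv.integral_adv_eq_zero hn hσ0 hσ1 hKh (fun ξ => (homExt_coe_eq K ξ).symm) hV

/-- Along the gradient of the last coordinate `ξ_i`, the derivative of `c (ξ_i + 2)` is `c (1 -
ξ_i²) ≥ 0`. The identity would make a continuous nonnegative function with zero integral vanish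
everywhere. -/
lemma not_isPositiveSolution_coord (hn : 2 ≤ n) {σ : ℝ} (hσ0 : 0 < σ) (hσ1 : σ < 1) {c : ℝ}
    (hc : 0 < c) (v : Sph n → ℝ) :
    ¬ IsPositiveSolution n σ (fun ξ => c * ((ξ : Amb n) (Fin.last n) + 2)) v := by
  intro hv
  set q : ℝ := 2 * (n : ℝ) / ((n : ℝ) - 2 * σ) with hq
  set i := Fin.last n with hi
  have h0 : HomogC1 0 fun x : Amb n => ‖x‖ ^ (-1 : ℝ) * x i :=
    ((homogC1_norm_rpow (-1)).mul (homogC1_coord i)).congr_degree (by norm_num)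
  have hK : HomogC1 0 fun x : Amb n => c * (‖x‖ ^ (-1 : ℝ) * x i + 2) :=
    ⟨fun x hx => contDiffAt_const.mul ((h0.contDiffAt x hx).add contDiffAt_const),
      fun t ht x hx => by
        have := h0.hom t ht x hx
        beta_reduce at this ⊢
        rw [this]; simp⟩
  have h1 := hv.integral_adv_eq_zero hn hσ0 hσ1 hK (fun ξ => by simp) (conformalData_coord i)
  have hadv : ∀ ξ : Sph n, adv (fun j x => ‖x‖ ^ (1 : ℝ) * (if j = i then 1 else 0) -
      ‖x‖ ^ (-1 : ℝ) * (x i * x j)) (fun x : Amb n => c * (‖x‖ ^ (-1 : ℝ) * x i + 2)) ξ =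
      c * (1 - (ξ : Amb n) i ^ 2) := by
    intro ξ
    have hξ := coe_ne_zero ξ
    have e : ∀ j, pd j (fun x : Amb n => c * (‖x‖ ^ (-1 : ℝ) * x i + 2)) ξ =
        c * ((if j = i then 1 else 0) - (ξ : Amb n) i * (ξ : Amb n) j) := by
      intro j
      have d2 : DifferentiableAt ℝ (fun _ : Amb n => (2 : ℝ)) (ξ : Amb n) :=
        differentiableAt_const _
      have dc : DifferentiableAt ℝ (fun x : Amb n => x i) (ξ : Amb n) := by fun_prop
      rw [pd_const_mul c ((h0.differentiableAt hξ).fun_add d2), pd_add (h0.differentiableAt hξ) d2,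
        pd_mul ((homogC1_norm_rpow (-1)).differentiableAt hξ) dc, pd_norm_rpow _ _ hξ, pd_coord]
      have d3 : pd j (fun _ : Amb n => (2 : ℝ)) ξ = 0 := by simp [pd]
      simp only [d3, norm_coe, Real.one_rpow]
      ring
    simp only [adv, e, norm_coe, Real.one_rpow, one_mul]
    have e2 : ∀ j, ((if j = i then 1 else 0) - (ξ : Amb n) i * (ξ : Amb n) j) *
        (c * ((if j = i then 1 else 0) - (ξ : Amb n) i * (ξ : Amb n) j)) =
        (if j = i then c - 2 * c * ((ξ : Amb n) i * (ξ : Amb n) j) else 0) +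
          c * (ξ : Amb n) i ^ 2 * ((ξ : Amb n) j * (ξ : Amb n) j) := by
      intro j
      split_ifs <;> ring
    simp_rw [e2]
    rw [Finset.sum_add_distrib, ← Finset.mul_sum, sum_coe_mul_self, Finset.sum_ite_eq']
    simp only [Finset.mem_univ, if_true]
    ring
  simp_rw [hadv] at h1
  have hcont : Continuous fun ξ : Sph n => c * (1 - (ξ : Amb n) i ^ 2) * v ξ ^ q :=
    (by fun_prop : Continuous fun ξ : Sph n => c * (1 - (ξ : Amb n) i ^ 2)).mul
      (hv.contMDiff.continuous.rpow_const fun ξ => Or.inl (hv.pos ξ).ne')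
  have hnonneg : ∀ ξ : Sph n, 0 ≤ c * (1 - (ξ : Amb n) i ^ 2) * v ξ ^ q := fun ξ => by
    have h2 : (ξ : Amb n) i ^ 2 ≤ 1 := by
      have h3 := sum_coe_mul_self ξ
      rw [sq]
      refine le_of_le_of_eq ?_ h3
      exact Finset.single_le_sum (f := fun j => (ξ : Amb n) j * (ξ : Amb n) j)
        (fun j _ => mul_self_nonneg _) (Finset.mem_univ i)
    exact mul_nonneg (mul_nonneg hc.le (by linarith)) (Real.rpow_nonneg (hv.pos ξ).le q)
  have h2 := (Continuous.ae_eq_iff_eq (surf n) hcont (continuous_const (y := (0 : ℝ)))).1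
    ((integral_eq_zero_iff_of_nonneg hnonneg (integrable_surf hcont)).1 h1)
  -- A point on the equator: its last coordinate is zero because `n ≠ 0`, and the integrand there is
  -- `c * v ξ ^ q > 0`.
  let ξ : Sph n := ⟨EuclideanSpace.single 0 1, by simp⟩
  have h3 := congrFun h2 ξ
  have hξi : (ξ : Amb n) i = 0 := by
    have : i ≠ 0 := by
      rw [hi, Ne, Fin.ext_iff, Fin.val_last, Fin.val_zero]
      omega
    simp [ξ, this]
  have h4 := Real.rpow_pos_of_pos (hv.pos ξ) q
  simp only [hξi] at h3
  have h5 : c * v ξ ^ q = 0 := by linear_combination h3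
  exact (mul_pos hc h4).ne' h5

end KazdanWarner

end

theorem mainTheorem12 (n : ℕ) (hn : 2 ≤ n) (σ : ℝ) (hσ0 : 0 < σ) (hσ1 : σ < 1) :
    (∀ K v : KazdanWarner.Sph n → ℝ,
      ContMDiff (𝓡 n) 𝓘(ℝ, ℝ) 1 K → (∀ ξ, 0 < K ξ) →
      KazdanWarner.IsPositiveSolution n σ K v →
      ∀ X : (ξ : KazdanWarner.Sph n) → TangentSpace (𝓡 n) ξ,
        KazdanWarner.IsConformalKilling X →
        ∫ ξ, KazdanWarner.dirDeriv X K ξ * v ξ ^ (2 * (n : ℝ) / ((n : ℝ) - 2 * σ))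
          ∂(KazdanWarner.surf n) = 0) ∧
    (∀ c : ℝ, 0 < c →
      ¬ ∃ v : KazdanWarner.Sph n → ℝ,
        KazdanWarner.IsPositiveSolution n σ
          (fun ξ => c * ((ξ : KazdanWarner.Amb n) (Fin.last n) + 2)) v) :=
  ⟨fun _ _ hK _ hv _ hX => hv.integral_dirDeriv_eq_zero hn hσ0 hσ1 hK hX,
    fun _ hc ⟨v, hv⟩ => KazdanWarner.not_isPositiveSolution_coord hn hσ0 hσ1 hc v hv⟩
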